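/- Let $k$ be a field, let $G=\operatorname{Spec}A$ be an affine algebraic group over $k$ (an affine group scheme of finite type), embedded as a closed subset $G\subseteq\mathbb{A}^n_k$ by coordinate functions $x_1,\dots,x_n$ generating $A$, and let $\alpha:Y\times G\to Y$ be a right action on an affine $k$-scheme $Y$ which is closed in $\operatorname{Spec}B$, where $B$ is a finitely generated $k$-algebra (for example $\operatorname{Spec}B=\mathbb{A}^m_k$ or $\operatorname{Spec}B=Y$). Let $y\in Y(k)$, let $\alpha_y:G\to Y$, $g\mapsto yg$, be the orbit morphism, let $yG\subseteq\operatorname{Spec}B$ be its image, and let $\Gamma\subseteq\mathbb{A}^n_B=\operatorname{Spec}B[x_1,\dots,x_n]$ be its graph, with base projection $\pi:\mathbb{A}^n_B\to\operatorname{Spec}B$. For closed $\Gamma_0\subseteq\mathbb{A}^n_B$ let $\widehat\Gamma_0$ be its closure in $\mathbb{P}^n_B$, let $\Gamma_0^\infty=\widehat\Gamma_0\cap H$ with $H=\mathbb{P}^n_B\setminus\mathbb{A}^n_B$, and let $\widehat\pi:\mathbb{P}^n_B\to\operatorname{Spec}B$ be the projection. The relative boundary of a subset $E$ of a topological space is $\underline\partial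 E=\overline{\overline E\setminus E}$; a relative boundary hull of a nonempty $E$ is a closed $D$ with $\overline E\setminus E\subseteq D\subsetneq\overline E$. Consider these algorithms. (Z) $\mathrm{ZeroDimensionalFibers}(\Gamma)$. Start with $\Gamma_0'=\Gamma$, the counter $s=1$ and the empty list $\ell$. While $\dim\Gamma_0'-\dim\pi(\Gamma_0')>0$: choose a hyperplane $E$ with coefficients in $k$ and put $\Gamma_0''=\Gamma_0'\cap E$; if $\dim\Gamma_0''<\dim\Gamma_0'$, then - if $\overline{\pi(\Gamma_0')}\subseteq\overline{\pi(\Gamma_0'')}$, replace $\Gamma_0'$ by $\Gamma_0''$; - otherwise, if $s>n$, let $\Delta=\overline{\overline{\pi(\Gamma_0')}\setminus\overline{\pi(\Gamma_0'')}}$; if $\overline{\pi(\Gamma_0')}\not\subseteq\Delta$, replace $\Gamma_0'$ by $\pi^{-1}(\overline{\pi(\Gamma_0'')})\cap\Gamma$ and add $\pi^{-1}(\Delta)\cap\Gamma$ to $\ell$; else, if $s>4n$, replace $\Gamma_0'$ by one of its irreducible components and add the others to $\ell$. Then increase $s$ by $1$. At the end return $[\Gamma_0',\ell]$, and let $\Gamma_0$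 be the union of $\Gamma_0'$ and the members of $\ell$. (L) $\mathrm{LocallyClosedApproximation}(\Gamma)$: obtain $\Gamma_0$ from (Z) and return the pair $\overline{\pi(\Gamma_0)},\ \widehat\pi(\Gamma_0^\infty)$. "Skipping (Z)" means taking $\Gamma_0=\Gamma$. (C) $\mathrm{ConstructibleProjection}(\Gamma)$: start with $C=\emptyset$; while $\Gamma\neq\emptyset$, let $(A,D)$ be the result of (L) for the current $\Gamma$, add $A\setminus D$ to $C$, and replace $\Gamma$ by $\Gamma\cap\pi^{-1}(D)$. Return $C$. Assume that $\alpha_y$ is injective (as a map of prime spectra). Then: 1. $\Gamma$ is closed, $\pi(\Gamma)=yG$, all nonempty fibres of $\pi|_\Gamma$ have dimension $0$, and $\dim\Gamma=\dim\pi(\Gamma)$. Hence (Z) with input $\Gamma$ can only return $\Gamma_0'=\Gamma$ and $\ell=[\,]$, and (L) with input $\Gamma$ returns the same values with and without (Z); that is, (Z) can be skipped. 2. $\widehat\pi(\Gamma^\infty)$ is a relative boundary hull of $yG$; it is $G$-equivariant, in the sense that the inverse images in $Y\times G$ of $\widehat\pi(\Gamma^\infty)\cap Y$ under $\alpha$ and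 under the projection to $Y$ agree; and $\widehat\pi(\Gamma^\infty)=\underline\partial(yG)$. So (L) returns exactly $\overline{yG}$ and $\underline\partial(yG)$. 3. $\Gamma\cap\pi^{-1}(\widehat\pi(\Gamma^\infty))=\emptyset$, and (C) with input $\Gamma$ (with (Z) or with (Z) skipped) stops after exactly one call of (L), whose result is $(\overline{yG},\underline\partial(yG))$; its output is $yG=\overline{yG}\setminus\underline\partial(yG)$. -/

import Mathlib

open scoped TensorProduct

namespace OrbitImage

noncomputable section

/-! ### Relative boundaries in a topological space -/

section Topology

variable {Y : Type*} [TopologicalSpace Y]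

/-- The relative boundary of `A`: the closure of `closure A \ A`. -/
def relativeBoundary (A : Set Y) : Set Y :=
  closure (closure A \ A)

/-- `D` is a relative boundary hull of `A`: it is closed and, if `A` is nonempty,
`closure A \ A ⊆ D ⊊ closure A`; the only relative boundary hull of `∅` is `∅`. -/
structure IsRelativeBoundaryHull (D A : Set Y) : Prop where
  isClosed : IsClosed D
  eq_empty : A = ∅ → D = ∅
  subset : A.Nonempty → closure A \ A ⊆ D
  ssubset : A.Nonempty → D ⊂ closure A

/-- The irreducible components of a subset `Z`: its maximal irreducible subsets. -/
def IsComponentOf (P Z : Set Y) : Prop :=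
  Maximal (fun T : Set Y => IsIrreducible T ∧ T ⊆ Z) P

end Topology

/-! ### Relative affine and projective space over `Spec B` -/

section Spaces

variable (B : Type*) [CommRing B] (n : ℕ)

/-- Relative affine space `𝔸ⁿ_B = Spec B[x₁,…,xₙ]`. -/
abbrev AffineSp : Type _ := PrimeSpectrum (MvPolynomial (Fin n) B)

/-- The standard grading of `B[x₀,…,xₙ]` by total degree. -/
instance homogeneousGrading :
    GradedAlgebra (MvPolynomial.homogeneousSubmodule (Fin (n + 1)) B) :=
  MvPolynomial.gradedAlgebra

/-- Relative projective space `ℙⁿ_B = Proj B[x₀,…,xₙ]`, as a topological space. -/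
abbrev ProjSp : Type _ :=
  ProjectiveSpectrum (MvPolynomial.homogeneousSubmodule (Fin (n + 1)) B)

variable {B n}

/-- The base projection `π : 𝔸ⁿ_B → Spec B`. -/
def baseProj : AffineSp B n → PrimeSpectrum B :=
  PrimeSpectrum.comap (MvPolynomial.C (σ := Fin n) (R := B))

/-- The extended base projection `π̂ : ℙⁿ_B → Spec B`. -/
def projBaseProj (q : ProjSp B n) : PrimeSpectrum B :=
  ⟨q.asHomogeneousIdeal.toIdeal.comap (MvPolynomial.C (σ := Fin (n + 1)) (R := B)),
    Ideal.comap_isPrime _ _⟩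

variable (B n) in
/-- Dehomogenization `B[x₀,…,xₙ] → B[x₁,…,xₙ]`, `x₀ ↦ 1`. -/
def dehomogenize : MvPolynomial (Fin (n + 1)) B →+* MvPolynomial (Fin n) B :=
  MvPolynomial.eval₂Hom MvPolynomial.C (Fin.cons 1 MvPolynomial.X)

/-- The standard open embedding `𝔸ⁿ_B → ℙⁿ_B` onto the chart `x₀ ≠ 0`: a prime `p` is sent to the
ideal generated by the homogeneous polynomials whose dehomogenization lies in `p`. -/
def affineToProj (p : AffineSp B n) : ProjSp B n where
  asHomogeneousIdeal :=
    Ideal.homogeneousCore (MvPolynomial.homogeneousSubmodule (Fin (n + 1)) B)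
      (p.asIdeal.comap (dehomogenize B n))
  isPrime := Ideal.IsPrime.homogeneousCore (Ideal.comap_isPrime _ _)
  not_irrelevant_le := by
    intro h
    have hX : (MvPolynomial.X 0 : MvPolynomial (Fin (n + 1)) B) ∈
        HomogeneousIdeal.irrelevant
          (MvPolynomial.homogeneousSubmodule (Fin (n + 1)) B) := by
      rw [HomogeneousIdeal.mem_irrelevant_iff, GradedRing.proj_apply,
        DirectSum.decompose_of_mem_ne _ (i := 1) (j := 0)
          ((MvPolynomial.mem_homogeneousSubmodule _ _).2 (MvPolynomial.isHomogeneous_X _ _))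
          one_ne_zero]
    have h2 := Ideal.toIdeal_homogeneousCore_le _ _ (h hX)
    rw [Ideal.mem_comap] at h2
    have h3 : dehomogenize B n (MvPolynomial.X 0) = 1 := by simp [dehomogenize]
    rw [h3] at h2
    exact p.isPrime.ne_top ((Ideal.eq_top_iff_one _).2 h2)

variable (B n) in
/-- The hyperplane at infinity `H = V(x₀)`, the complement of `𝔸ⁿ_B` in `ℙⁿ_B`. -/
def hyperplaneAtInfinity : Set (ProjSp B n) :=
  ProjectiveSpectrum.zeroLocus _ {MvPolynomial.X 0}

/-- The projective closure `Γ̂` of `Γ ⊆ 𝔸ⁿ_B` in `ℙⁿ_B`. -/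
def projClosure (Γ : Set (AffineSp B n)) : Set (ProjSp B n) :=
  closure (affineToProj '' Γ)

/-- The points at infinity `Γ^∞ = Γ̂ ∩ H`. -/
def pointsAtInfinity (Γ : Set (AffineSp B n)) : Set (ProjSp B n) :=
  projClosure Γ ∩ hyperplaneAtInfinity B n

/-- `π̂(Γ^∞)`. -/
def imageAtInfinity (Γ : Set (AffineSp B n)) : Set (PrimeSpectrum B) :=
  projBaseProj '' pointsAtInfinity Γ

end Spaces

/-! ### The algorithms, acting on closed subsets of `𝔸ⁿ_B` -/

section Algorithms

variable (k : Type*) [Field k] {B : Type*} [CommRing B] [Algebra k B] {n : ℕ}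

/-- Hyperplanes `c₀ + c₁x₁ + ⋯ + cₙxₙ = 0` of `𝔸ⁿ_B` with coefficients in `k`
(constant over `Spec B`). -/
def IsConstantHyperplane (E : Set (AffineSp B n)) : Prop :=
  ∃ (c₀ : k) (c : Fin n → k), c ≠ 0 ∧
    E = PrimeSpectrum.zeroLocus
      {MvPolynomial.C (algebraMap k B c₀) +
        ∑ i, MvPolynomial.C (algebraMap k B (c i)) * MvPolynomial.X i}

/-- The loop condition `dim Γ' - dim π(Γ') > 0`. -/
def PositiveFiberDim (Γ' : Set (AffineSp B n)) : Prop :=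
  topologicalKrullDim ↥(baseProj '' Γ') < topologicalKrullDim ↥Γ'

/-- The effect of one pass through the loop of the fibre dimension reduction: with input `Γ`,
candidate `Γ'`, step counter `s`, list `l` of additional components, and chosen hyperplane `E`,
the new candidate and list are the last two arguments. -/
inductive FiberReductionStep (Γ Γ' : Set (AffineSp B n)) (s : ℕ) (l : List (Set (AffineSp B n)))
    (E : Set (AffineSp B n)) : Set (AffineSp B n) → List (Set (AffineSp B n)) → Prop
  /-- the intersection with `E` does not decrease the dimension -/
  | sameDim (h : ¬ topologicalKrullDim ↥(Γ' ∩ E) < topologicalKrullDim ↥Γ') :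
      FiberReductionStep Γ Γ' s l E Γ' l
  /-- the dimension decreases and the image closure does not -/
  | shrink (h : topologicalKrullDim ↥(Γ' ∩ E) < topologicalKrullDim ↥Γ')
      (him : closure (baseProj '' Γ') ⊆ closure (baseProj '' (Γ' ∩ E))) :
      FiberReductionStep Γ Γ' s l E (Γ' ∩ E) l
  /-- the image closure decreases, and the counter does not allow any splitting -/
  | early (h : topologicalKrullDim ↥(Γ' ∩ E) < topologicalKrullDim ↥Γ')
      (him : ¬ closure (baseProj '' Γ') ⊆ closure (baseProj '' (Γ' ∩ E)))
      (hs : s ≤ n) :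
      FiberReductionStep Γ Γ' s l E Γ' l
  /-- split along the decomposition of the image closure -/
  | splitBase (h : topologicalKrullDim ↥(Γ' ∩ E) < topologicalKrullDim ↥Γ')
      (him : ¬ closure (baseProj '' Γ') ⊆ closure (baseProj '' (Γ' ∩ E)))
      (hs : n < s) (Δ : Set (PrimeSpectrum B))
      (hΔ : Δ = closure (closure (baseProj '' Γ') \ closure (baseProj '' (Γ' ∩ E))))
      (hsplit : ¬ closure (baseProj '' Γ') ⊆ Δ) :
      FiberReductionStep Γ Γ' s l E
        (baseProj ⁻¹' closure (baseProj '' (Γ' ∩ E)) ∩ Γ) (l ++ [baseProj ⁻¹' Δ ∩ Γ])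
  /-- neither the base splits nor does the counter allow a decomposition into irreducibles -/
  | unsplit (h : topologicalKrullDim ↥(Γ' ∩ E) < topologicalKrullDim ↥Γ')
      (him : ¬ closure (baseProj '' Γ') ⊆ closure (baseProj '' (Γ' ∩ E)))
      (hs : n < s) (Δ : Set (PrimeSpectrum B))
      (hΔ : Δ = closure (closure (baseProj '' Γ') \ closure (baseProj '' (Γ' ∩ E))))
      (hsplit : closure (baseProj '' Γ') ⊆ Δ) (hs' : s ≤ 4 * n) :
      FiberReductionStep Γ Γ' s l E Γ' l
  /-- decompose the candidate into its irreducible components -/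
  | decompose (h : topologicalKrullDim ↥(Γ' ∩ E) < topologicalKrullDim ↥Γ')
      (him : ¬ closure (baseProj '' Γ') ⊆ closure (baseProj '' (Γ' ∩ E)))
      (hs : n < s) (Δ : Set (PrimeSpectrum B))
      (hΔ : Δ = closure (closure (baseProj '' Γ') \ closure (baseProj '' (Γ' ∩ E))))
      (hsplit : closure (baseProj '' Γ') ⊆ Δ) (hs' : 4 * n < s)
      (P₁ : Set (AffineSp B n)) (P : List (Set (AffineSp B n)))
      (hnodup : (P₁ :: P).Nodup) (hP : ∀ Z, Z ∈ P₁ :: P ↔ IsComponentOf Z Γ') :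
      FiberReductionStep Γ Γ' s l E P₁ (l ++ P)

/-- The loop of the fibre dimension reduction, from the state `(Γ', s, l)` to its returned value
(the last two arguments); the hyperplane is chosen freely in each pass. -/
inductive FiberReductionLoop (Γ : Set (AffineSp B n)) :
    Set (AffineSp B n) → ℕ → List (Set (AffineSp B n)) →
    Set (AffineSp B n) → List (Set (AffineSp B n)) → Prop
  | exit {Γ' s l} (h : ¬ PositiveFiberDim Γ') : FiberReductionLoop Γ Γ' s l Γ' l
  | pass {Γ' s l E Γ₁ l₁ Γ₂ l₂} (h : PositiveFiberDim Γ')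
      (hE : IsConstantHyperplane k E)
      (hstep : FiberReductionStep Γ Γ' s l E Γ₁ l₁)
      (hrest : FiberReductionLoop Γ Γ₁ (s + 1) l₁ Γ₂ l₂) :
      FiberReductionLoop Γ Γ' s l Γ₂ l₂

/-- `ZeroDimensionalFibers` can return `[Γ₀', l]` on the input `Γ`. -/
def ZeroDimensionalFibers (Γ Γ₀' : Set (AffineSp B n)) (l : List (Set (AffineSp B n))) : Prop :=
  FiberReductionLoop k Γ Γ 1 [] Γ₀' l

/-- `LocallyClosedApproximationOfProjection` can return `A, D` on the input `Γ`: reduce the fibre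
dimension of `Γ` to get `Γ₀ = Γ₀' ∪ ⋃ l`, and return the closure of `π(Γ₀)` and `π̂(Γ₀^∞)`. -/
def LocallyClosedApprox (Γ : Set (AffineSp B n)) (A D : Set (PrimeSpectrum B)) : Prop :=
  ∃ (Γ₀' : Set (AffineSp B n)) (l : List (Set (AffineSp B n))) (Γ₀ : Set (AffineSp B n)),
    ZeroDimensionalFibers k Γ Γ₀' l ∧ Γ₀ = Γ₀' ∪ {x | ∃ Z ∈ l, x ∈ Z} ∧
      A = closure (baseProj '' Γ₀) ∧ D = imageAtInfinity Γ₀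

/-- `LocallyClosedApproximationOfProjection` with the fibre dimension reduction skipped, that is,
with `Γ₀ = Γ`. -/
def LocallyClosedApproxSkip (Γ : Set (AffineSp B n)) (A D : Set (PrimeSpectrum B)) : Prop :=
  A = closure (baseProj '' Γ) ∧ D = imageAtInfinity Γ

/-- The outer iteration `ConstructibleProjection`, for a given sub-algorithm `lca`: on the input
`Γ` it can terminate with the list `[(A₁, D₁), (A₂, D₂), …]` of the values returned by the
successive calls of `lca`; it outputs the union of the sets `Aᵢ \ Dᵢ`. -/
inductive ConstructibleProjection
    (lca : Set (AffineSp B n) → Set (PrimeSpectrum B) → Set (PrimeSpectrum B) → Prop) :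
    Set (AffineSp B n) → List (Set (PrimeSpectrum B) × Set (PrimeSpectrum B)) → Prop
  | done : ConstructibleProjection lca ∅ []
  | iterate {Γ A D L} (hne : Γ.Nonempty) (hcall : lca Γ A D)
      (hrest : ConstructibleProjection lca (Γ ∩ baseProj ⁻¹' D) L) :
      ConstructibleProjection lca Γ ((A, D) :: L)

end Algorithms

/-! ### Actions of affine algebraic groups and orbit morphisms -/

section Actions

variable (k : Type*) [Field k]

/-- A right action `α : Y × G → Y` of the affine group scheme `G = Spec A` on `Y = Spec S`, given
by its comorphism `S → S ⊗ A`. -/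
structure RightAction (S A : Type*) [CommRing S] [Algebra k S] [CommRing A] [HopfAlgebra k A] where
  /-- the comorphism of `α` -/
  comorphism : S →ₐ[k] S ⊗[k] A
  /-- `(y g) h = y (g h)` -/
  mul_act : (Algebra.TensorProduct.assoc k k k S A A).toAlgHom.comp
      ((Algebra.TensorProduct.map comorphism (AlgHom.id k A)).comp comorphism) =
    (Algebra.TensorProduct.map (AlgHom.id k S) (Bialgebra.comulAlgHom k A)).comp comorphism
  /-- `y 1 = y` -/
  one_act : (Algebra.TensorProduct.rid k k S).toAlgHom.comp
      ((Algebra.TensorProduct.map (AlgHom.id k S) (Bialgebra.counitAlgHom k A)).comp comorphism) =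
    AlgHom.id k S

variable {k} {S A : Type*} [CommRing S] [Algebra k S] [CommRing A] [HopfAlgebra k A]

/-- The comorphism `S → S ⊗ A → k ⊗ A = A` of the orbit morphism `α_y : G → Y`, `g ↦ y g`, of a
`k`-rational point `y : S → k` of `Y`. -/
def RightAction.orbitHom (α : RightAction k S A) (y : S →ₐ[k] k) : S →ₐ[k] A :=
  (Algebra.TensorProduct.lid k A).toAlgHom.comp
    ((Algebra.TensorProduct.map y (AlgHom.id k A)).comp α.comorphism)

/-- The orbit morphism `α_y : G → Y` on points of prime spectra. -/
def RightAction.orbitMap (α : RightAction k S A) (y : S →ₐ[k] k) :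
    PrimeSpectrum A → PrimeSpectrum S :=
  PrimeSpectrum.comap (α.orbitHom y).toRingHom

/-- A set `D` of points of `Y` is `G`-equivariant: its inverse images in `Y × G` under the action
and under the projection to `Y` agree. -/
def RightAction.IsInvariant (α : RightAction k S A) (D : Set (PrimeSpectrum S)) : Prop :=
  PrimeSpectrum.comap α.comorphism.toRingHom ⁻¹' D =
    PrimeSpectrum.comap
      (Algebra.TensorProduct.includeLeft : S →ₐ[k] S ⊗[k] A).toRingHom ⁻¹' D

variable {B : Type*} [CommRing B] [Algebra k B] {n : ℕ}

/-- The graph `{(f(g), g)} ⊆ Spec B × G ⊆ 𝔸ⁿ_B` of a morphism `f : G = Spec A → Spec B` with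
comorphism `f`, where `x = (x₁,…,xₙ)` are the coordinate functions of an embedding `G ⊆ 𝔸ⁿ_k`:
the image of `G` under `(f, x)`. -/
def graph (f : B →ₐ[k] A) (x : Fin n → A) : Set (AffineSp B n) :=
  Set.range (PrimeSpectrum.comap (MvPolynomial.eval₂Hom f.toRingHom x))

end Actions

end

end OrbitImage

/-!
The whole statement follows from one description of `π̂(Γ^∞)`. For a ring homomorphism `f : B → A`,
the *locus of integrality* `W(f) ⊆ Spec B` consists of the primes `q` such that every element of
`A` becomes integral over `B` locally at `q`.

* `imageAtInfinity_range`: if `Γ` is the graph of `Spec A → Spec B` in affine space, then `π̂(Γ^∞)`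
  is the complement of `W(f)`. A point at infinity over `q ∈ W(f)` is excluded by homogenizing
  integral equations. Conversely, if there is no point at infinity over `q`, then elimination theory
  (`exists_isHomogeneous_mul_mem`) and Nakayama's lemma show that, locally at `q`, the polynomials
  of some degree `d` in the coordinates already span those of degree `d + 1`, so that the
  coordinates are integral.
* `RightAction.isInvariant_integralLocus`: for an orbit morphism `α_y : G → Y`, the locus of
  integrality is invariant. It commutes with the base change `Y × G → Y`
  (`mem_integralLocus_map_id_iff`, where descent holds by comparing coefficients in a basis of `A`
  over `k`), and `α_y × id` commutes with the automorphisms `(y, g) ↦ (y g, g)` of `Y × G` and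
  `(g, g') ↦ (g g', g')` of `G × G`.
* `mem_integralLocus_of_mem_minimalPrimes`: since `α_y` is injective, the locus of integrality
  contains the generic points of the orbit closure. Being invariant, it contains the orbit
  (`RightAction.range_orbitMap_subset_integralLocus`).

By lying over (`exists_comap_eq_of_mem_integralLocus`), a point of the orbit closure in the locus of
integrality belongs to the orbit. Hence `closure (yG) \ yG` is the complement of the locus of
integrality, a closed set, and this is also `π̂(Γ^∞)`; lying over also makes `G → yG` a closed map,
hence a homeomorphism, so that `Γ` and `yG` have the same dimension. The algorithms then stop at
once.
-/

namespace OrbitImage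

/-! ### The locus over which a ring homomorphism is integral -/

section IntegralLocus

variable {R A : Type*} [CommRing R] [CommRing A]

/-- The elements `a` of `A` that become integral over `R` after localization at the prime `q`;
denominators are cleared, so that no localization occurs: `f s * a` is integral for some
`s ∉ q`. -/
def integralAt (f : R →+* A) (q : PrimeSpectrum R) : Subring A where
  carrier := {a | ∃ s ∉ q.asIdeal, f.IsIntegralElem (f s * a)}
  one_mem' := ⟨1, q.isPrime.one_notMem, by simpa using f.isIntegralElem_map (x := 1)⟩
  zero_mem' := ⟨1, q.isPrime.one_notMem, by simpa using f.isIntegralElem_map (x := 0)⟩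
  neg_mem' := by
    rintro a ⟨s, hs, h⟩
    exact ⟨s, hs, by simpa using h.neg⟩
  add_mem' := by
    rintro a b ⟨s, hs, h⟩ ⟨t, ht, h'⟩
    refine ⟨s * t, q.isPrime.mul_notMem hs ht, ?_⟩
    have := ((f.isIntegralElem_map (x := t)).mul f h).add f
      ((f.isIntegralElem_map (x := s)).mul f h')
    convert this using 1
    rw [map_mul]; ring
  mul_mem' := by
    rintro a b ⟨s, hs, h⟩ ⟨t, ht, h'⟩
    refine ⟨s * t, q.isPrime.mul_notMem hs ht, ?_⟩
    convert h.mul f h' using 1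
    rw [map_mul]; ring

lemma map_mem_integralAt (f : R →+* A) (q : PrimeSpectrum R) (r : R) : f r ∈ integralAt f q :=
  ⟨1, q.isPrime.one_notMem, by simpa using f.isIntegralElem_map (x := r)⟩

/-- The set of primes `q` of `R` such that `A` is integral over `R` locally at `q`. -/
def integralLocus (f : R →+* A) : Set (PrimeSpectrum R) := {q | integralAt f q = ⊤}

lemma mem_integralLocus {f : R →+* A} {q : PrimeSpectrum R} :
    q ∈ integralLocus f ↔ ∀ a, ∃ s ∉ q.asIdeal, f.IsIntegralElem (f s * a) := by
  rw [integralLocus, Set.mem_ofPred_eq, eq_top_iff]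
  exact ⟨fun h a => h (Subring.mem_top a), fun h a _ => h a⟩

/-- An element is integral at `q` as soon as it is a root, up to nilpotents, of a polynomial whose
leading coefficient is a unit at `q`. -/
lemma mem_integralAt_of_isNilpotent_eval₂ {f : R →+* A} {q : PrimeSpectrum R} {a : A}
    {p : Polynomial R} {N : ℕ} (hN : p.natDegree ≤ N) (hc : p.coeff N ∉ q.asIdeal)
    (hp : IsNilpotent (p.eval₂ f a)) : a ∈ integralAt f q := by
  obtain ⟨M, hM⟩ := hp
  have hcoeff : (p ^ M).coeff (M * N) ∉ q.asIdeal := by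
    rw [Polynomial.coeff_pow_of_natDegree_le hN]
    exact fun h => hc (q.isPrime.mem_of_pow_mem _ h)
  have hdeg : (p ^ M).natDegree = M * N :=
    Polynomial.natDegree_eq_of_le_of_coeff_ne_zero
      (Polynomial.natDegree_pow_le.trans (Nat.mul_le_mul_left _ hN))
      (fun h => hcoeff (h ▸ q.asIdeal.zero_mem))
  refine ⟨(p ^ M).leadingCoeff, ?_, f.isIntegralElem_leadingCoeff_mul _ _ ?_⟩
  · rwa [Polynomial.leadingCoeff, hdeg]
  · rw [Polynomial.eval₂_pow, hM]

lemma mem_integralLocus_of_forall_mem {σ : Type*} {f : R →+* A} {x : σ → A}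
    (hx : Function.Surjective (MvPolynomial.eval₂Hom f x)) {q : PrimeSpectrum R}
    (h : ∀ i, x i ∈ integralAt f q) : q ∈ integralLocus f := by
  refine eq_top_iff.2 fun a _ => ?_
  obtain ⟨g, rfl⟩ := hx a
  induction g using MvPolynomial.induction_on with
  | C r => simpa using map_mem_integralAt f q r
  | add g g' hg hg' => rw [map_add]; exact add_mem (hg trivial) (hg' trivial)
  | mul_X g i hg =>
    rw [map_mul, MvPolynomial.eval₂Hom_X']
    exact mul_mem (hg trivial) (h i)

/-- The locus of integrality is open if `A` is generated over `R` by finitely many elements. -/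
lemma isOpen_integralLocus {σ : Type*} [Finite σ] {f : R →+* A} {x : σ → A}
    (hx : Function.Surjective (MvPolynomial.eval₂Hom f x)) : IsOpen (integralLocus f) := by
  classical
  cases nonempty_fintype σ
  rw [isOpen_iff_forall_mem_open]
  intro q hq
  choose s hs hsx using fun i => mem_integralLocus.1 hq (x i)
  refine ⟨PrimeSpectrum.basicOpen (∏ i, s i), ?_, (PrimeSpectrum.basicOpen _).2, ?_⟩
  · intro q' hq'
    refine mem_integralLocus_of_forall_mem hx fun i => ⟨s i, fun h => hq' ?_, hsx i⟩
    exact Ideal.mem_of_dvd _ (Finset.dvd_prod_of_mem _ (Finset.mem_univ i)) h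
  · change _ ∉ q.asIdeal
    rw [q.isPrime.prod_mem_iff]
    rintro ⟨i, _, hi⟩
    exact hs i hi

/-- Lying over at a point `q` of the locus of integrality: if `q` contains the contraction of an
ideal `I`, then some prime containing `I` lies over `q`. -/
lemma exists_comap_eq_of_mem_integralLocus {f : R →+* A} {q : PrimeSpectrum R}
    (hq : q ∈ integralLocus f) (I : Ideal A) (hI : I.comap f ≤ q.asIdeal) :
    ∃ P : PrimeSpectrum A, I ≤ P.asIdeal ∧ PrimeSpectrum.comap f P = q := by
  algebraize [f]
  -- Lying over holds for the integral closure `A'` of `R`, and `A` is locally equal to `A'`.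
  let A' := integralClosure R A
  obtain ⟨Q, hQI, hQ, hQq⟩ := Ideal.exists_ideal_over_prime_of_isIntegral (S := A') q.asIdeal
    (I.comap (algebraMap A' A)) (by
      rw [Ideal.comap_comap]
      exact hI)
  -- The ideal `K` of all `a` that lie in `Q` after multiplication by an element outside `q`.
  let K : Ideal A :=
    { carrier := {a | ∃ t ∉ q.asIdeal, ∃ b ∈ Q, algebraMap A' A b = f t * a}
      zero_mem' := ⟨1, q.isPrime.one_notMem, 0, Q.zero_mem, by simp⟩
      add_mem' := by
        rintro a a' ⟨t, ht, b, hb, h⟩ ⟨t', ht', b', hb', h'⟩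
        refine ⟨t * t', q.isPrime.mul_notMem ht ht',
          algebraMap R A' t' * b + algebraMap R A' t * b', Q.add_mem (Q.mul_mem_left _ hb) (Q.mul_mem_left _ hb'), ?_⟩
        rw [map_add, map_mul, map_mul, h, h', ← IsScalarTower.algebraMap_apply,
          ← IsScalarTower.algebraMap_apply, RingHom.algebraMap_toAlgebra, map_mul]
        ring
      smul_mem' := by
        rintro r a ⟨t, ht, b, hb, h⟩
        obtain ⟨t', ht', hr⟩ := mem_integralLocus.1 hq r
        refine ⟨t' * t, q.isPrime.mul_notMem ht' ht, ⟨f t' * r, hr⟩ * b, Q.mul_mem_left _ hb, ?_⟩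
        rw [map_mul, h, map_mul, smul_eq_mul]
        change f t' * r * _ = _
        ring }
  have hIK : I ≤ K := fun a ha => by
    obtain ⟨t, ht, hta⟩ := mem_integralLocus.1 hq a
    exact ⟨t, ht, ⟨f t * a, hta⟩, hQI (I.mul_mem_left _ ha), rfl⟩
  have hqK : q.asIdeal ≤ K.comap f := fun r hr =>
    ⟨1, q.isPrime.one_notMem, algebraMap R A' r, by rwa [← hQq, Ideal.mem_comap] at hr, by
      rw [← IsScalarTower.algebraMap_apply, map_one, one_mul]; rfl⟩
  obtain ⟨P, hP, hKP, hdisj⟩ := K.exists_le_prime_disjoint (q.asIdeal.primeCompl.map f) (by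
    rw [Set.disjoint_left]
    rintro _ ⟨t, ht, b, hb, h⟩ ⟨s, hs, rfl⟩
    refine q.isPrime.mul_notMem ht hs ?_
    rw [← hQq, Ideal.mem_comap]
    convert hb
    refine FaithfulSMul.algebraMap_injective A' A ?_
    rw [h, ← IsScalarTower.algebraMap_apply]
    exact map_mul f t s)
  refine ⟨⟨P, hP⟩, hIK.trans hKP, PrimeSpectrum.ext (le_antisymm ?_ ?_)⟩
  · intro r hr
    by_contra hrq
    exact Set.disjoint_left.1 hdisj hr ⟨r, hrq, rfl⟩
  · exact hqK.trans (Ideal.comap_mono hKP)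

/-- Generic integrality: if `Spec A → Spec R` is injective, then `A` is integral over `R` at the
generic points `q` of the closure of the image. Indeed the elements of the unique prime `P` over `q`
are nilpotent locally at `q`, and the residue field of `P` is finite over that of `q`, since `A` is
quasi-finite over `R`. -/
lemma mem_integralLocus_of_mem_minimalPrimes {f : R →+* A} (hf : f.FiniteType)
    (hinj : Function.Injective (PrimeSpectrum.comap f)) {q : PrimeSpectrum R}
    (hq : q.asIdeal ∈ (RingHom.ker f).minimalPrimes) : q ∈ integralLocus f := by
  algebraize [f]
  obtain ⟨P, hP, -, hPq⟩ := Ideal.exists_comap_eq_of_mem_minimalPrimes (I := ⊥) f q.asIdeal hq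
  rw [mem_integralLocus]
  intro a
  have hP' : P.LiesOver q.asIdeal := ⟨hPq.symm⟩
  have : Algebra.QuasiFinite R A :=
    Algebra.QuasiFinite.iff_finite_comap_preimage_singleton.2 fun p =>
      (Set.finite_singleton p).preimage hinj.injOn
  -- The residue field of `P` is finite over that of `q`, so `a` is algebraic over `R ⧸ q` mod `P`.
  let F := q.asIdeal.ResidueField
  let φ : F →+* P.ResidueField := Ideal.ResidueField.map q.asIdeal P f hPq.symm
  algebraize [φ]
  have : IsScalarTower R F P.ResidueField := .of_algebraMap_eq' <| by
    rw [RingHom.algebraMap_toAlgebra, IsScalarTower.algebraMap_eq R A P.ResidueField]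
    ext r
    exact (Ideal.ResidueField.map_algebraMap q.asIdeal P f hPq.symm r).symm
  have : Algebra.QuasiFinite F P.ResidueField := .of_restrictScalars R _ _
  have : Module.Finite F P.ResidueField := .of_quasiFinite
  let ψ : R ⧸ q.asIdeal →+* P.ResidueField := φ.comp (algebraMap (R ⧸ q.asIdeal) F)
  algebraize [ψ]
  have : IsScalarTower (R ⧸ q.asIdeal) F P.ResidueField := .of_algebraMap_eq' rfl
  have : Algebra.IsAlgebraic (R ⧸ q.asIdeal) P.ResidueField :=
    (IsFractionRing.comap_isAlgebraic_iff (A := R ⧸ q.asIdeal) (K := F)).2 inferInstance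
  obtain ⟨p₀, hp₀, hpa⟩ := Algebra.IsAlgebraic.isAlgebraic (R := R ⧸ q.asIdeal)
    (algebraMap A P.ResidueField a)
  -- A prime of `A` lying over a subset of `q` lies over `q` by minimality, hence equals `P`; so the
  -- elements of `P` are nilpotent locally at `q`.
  have hnil : ∀ c ∈ P, ∃ s ∉ q.asIdeal, IsNilpotent (f s * c) := by
    intro c hc
    by_contra! hcon
    obtain ⟨Q, hQ, -, hdisj⟩ := (⊥ : Ideal A).exists_le_prime_disjoint
      (q.asIdeal.primeCompl.map f ⊔ Submonoid.powers c) (by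
        rw [Set.disjoint_left]
        intro b hb hb'
        obtain rfl : b = 0 := hb
        obtain ⟨_, ⟨s, hs, rfl⟩, _, ⟨m, rfl⟩, h⟩ := Submonoid.mem_sup.1 hb'
        refine hcon s hs ⟨m + 1, ?_⟩
        have h' : f s * c ^ m = 0 := h
        calc (f s * c) ^ (m + 1) = (f s * c ^ m) * (f s ^ m * c) := by ring
          _ = 0 := by rw [h', zero_mul])
    have hle : Q.comap f ≤ q.asIdeal := by
      intro r hr
      by_contra hrq
      exact Set.disjoint_left.1 hdisj hr (Submonoid.mem_sup_left ⟨r, hrq, rfl⟩)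
    have hQq : Q.comap f = q.asIdeal :=
      le_antisymm hle (hq.2 ⟨inferInstance, Ideal.comap_mono (f := f) bot_le⟩ hle)
    have hQP := hinj (a₁ := ⟨Q, hQ⟩) (a₂ := ⟨P, hP⟩) (PrimeSpectrum.ext (hQq.trans hPq.symm))
    obtain rfl : Q = P := congrArg PrimeSpectrum.asIdeal hQP
    exact Set.disjoint_left.1 hdisj hc (Submonoid.mem_sup_right (Submonoid.mem_powers c))
  obtain ⟨p, rfl, hdeg⟩ := Polynomial.exists_degree_eq_of_mem_lifts (p := p₀)
    ((Polynomial.lifts_iff_set_range _).2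
      (Polynomial.map_surjective _ Ideal.Quotient.mk_surjective p₀))
  have hN : p.leadingCoeff ∉ q.asIdeal := by
    rw [← Ideal.Quotient.eq_zero_iff_mem, Polynomial.leadingCoeff,
      Polynomial.natDegree_eq_of_degree_eq hdeg, ← Polynomial.coeff_map]
    exact Polynomial.leadingCoeff_ne_zero.2 hp₀
  have hpP : p.eval₂ f a ∈ P := by
    rw [← Ideal.algebraMap_residueField_eq_zero, Polynomial.hom_eval₂]
    rw [Polynomial.aeval_def, Polynomial.eval₂_map] at hpa
    have hcomp : (algebraMap A P.ResidueField).comp f =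
        (algebraMap (R ⧸ q.asIdeal) P.ResidueField).comp (Ideal.Quotient.mk q.asIdeal) :=
      RingHom.ext fun r => (Ideal.ResidueField.map_algebraMap q.asIdeal P f hPq.symm r).symm
    rwa [hcomp]
  obtain ⟨s, hs, hsp⟩ := hnil _ hpP
  refine mem_integralAt_of_isNilpotent_eval₂ (p := Polynomial.C s * p) (N := p.natDegree)
    (Polynomial.natDegree_C_mul_le _ _) ?_ ?_
  · rw [Polynomial.coeff_C_mul]
    exact q.isPrime.mul_notMem hs hN
  · rwa [Polynomial.eval₂_mul, Polynomial.eval₂_C]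

end IntegralLocus

/-! ### Base change and invariance of the locus of integrality -/

section BaseChange

lemma mem_integralLocus_of_comap_mem {R A R' A' : Type*} [CommRing R] [CommRing A] [CommRing R']
    [CommRing A'] {f : R →+* A} {f' : R' →+* A'} {g : R →+* R'} {g' : A →+* A'}
    (hg' : Function.Surjective g') (hsq : g'.comp f = f'.comp g) {z : PrimeSpectrum R'}
    (hz : PrimeSpectrum.comap g z ∈ integralLocus f) : z ∈ integralLocus f' := by
  rw [mem_integralLocus] at hz ⊢
  intro a'
  obtain ⟨a, rfl⟩ := hg' a'
  obtain ⟨s, hs, h⟩ := hz a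
  refine ⟨g s, hs, ?_⟩
  have := h.map g'
  rw [hsq, map_mul, ← RingHom.comp_apply, hsq] at this
  exact this.of_comp

variable {k : Type*} [Field k] {S A C : Type*} [CommRing S] [Algebra k S] [CommRing A]
  [Algebra k A] [CommRing C] [Algebra k C]

/-- Integrality at a point descends along a base change `S → S ⊗ C` of `k`-algebras. If an element
of `A` satisfies an equation over `S ⊗ C` whose leading coefficient does not vanish at `z`, then
some coordinate of this coefficient in a basis of `C` over `k` does not vanish at the image of `z`,
and the same coordinate of the whole equation is the desired equation over `S`. -/
lemma mem_integralLocus_map_id_iff (h : S →ₐ[k] A) (z : PrimeSpectrum (S ⊗[k] C)) :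
    z ∈ integralLocus (Algebra.TensorProduct.map h (AlgHom.id k C)).toRingHom ↔
      PrimeSpectrum.comap (Algebra.TensorProduct.includeLeft : S →ₐ[k] S ⊗[k] C).toRingHom z ∈
        integralLocus h.toRingHom := by
  set h' : S ⊗[k] C →+* A ⊗[k] C := (Algebra.TensorProduct.map h (AlgHom.id k C)).toRingHom with hh'
  set i : S →+* S ⊗[k] C := (Algebra.TensorProduct.includeLeft : S →ₐ[k] S ⊗[k] C).toRingHom
  have hi : ∀ s, i s = s ⊗ₜ[k] 1 := fun s => rfl
  have hh'_tmul : ∀ s c, h' (s ⊗ₜ[k] c) = h s ⊗ₜ[k] c := fun s c => by simp [hh']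
  constructor
  · intro hz
    rw [mem_integralLocus] at hz
    refine eq_top_iff.2 fun a _ => ?_
    obtain ⟨s, hs, p, hp, hp0⟩ := hz (a ⊗ₜ 1)
    let b := Module.Basis.ofVectorSpace k C
    let bS := Algebra.TensorProduct.basis S b
    let bA := Algebra.TensorProduct.basis A b
    have hcoord : ∀ t u, bA.repr (h' u) t = h (bS.repr u t) := by
      intro t u
      induction u with
      | zero => simp
      | add u v hu hv => simp [hu, hv]
      | tmul s c =>
        rw [hh'_tmul, Algebra.TensorProduct.basis_repr_tmul, Algebra.TensorProduct.basis_repr_tmul]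
        simp
    set N := p.natDegree
    have hlead : p.coeff N * s ^ N ∉ z.asIdeal := by
      rw [hp.coeff_natDegree, one_mul]
      exact fun h => hs (z.isPrime.mem_of_pow_mem _ h)
    obtain ⟨t, ht⟩ : ∃ t, i (bS.repr (p.coeff N * s ^ N) t) ∉ z.asIdeal := by
      by_contra! hcon
      apply hlead
      rw [← bS.linearCombination_repr (p.coeff N * s ^ N), Finsupp.linearCombination_apply]
      refine Ideal.sum_mem _ fun t _ => ?_
      have := Ideal.mul_mem_right (bS t) _ (hcon t)
      change bS.repr _ t • bS t ∈ _
      rwa [Algebra.smul_def]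
    let r : Polynomial S :=
      ∑ j ∈ Finset.range (N + 1), Polynomial.monomial j (bS.repr (p.coeff j * s ^ j) t)
    refine mem_integralAt_of_isNilpotent_eval₂ (p := r) (N := N) ?_ ?_ ?_
    · refine Polynomial.natDegree_sum_le_of_forall_le _ _ fun j hj => ?_
      exact (Polynomial.natDegree_monomial_le _).trans (Nat.lt_succ_iff.1 (Finset.mem_range.1 hj))
    · simpa [r, Polynomial.finsetSum_coeff, Polynomial.coeff_monomial] using ht
    · suffices r.eval₂ h.toRingHom a = 0 from this ▸ IsNilpotent.zero
      have h0 := congrArg (fun u => bA.repr u t) hp0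
      simp only [Polynomial.eval₂_eq_sum_range, map_sum, map_zero, Finsupp.coe_zero,
        Pi.zero_apply, Finsupp.coe_finsetSum, Finset.sum_apply] at h0
      rw [Polynomial.eval₂_finsetSum, ← h0]
      refine Finset.sum_congr rfl fun j _ => ?_
      have : h' (p.coeff j) * (h' s * a ⊗ₜ[k] (1 : C)) ^ j = a ^ j • h' (p.coeff j * s ^ j) := by
        rw [mul_pow, Algebra.TensorProduct.tmul_pow, one_pow, map_mul, map_pow, Algebra.smul_def]
        change _ = ((a ^ j) ⊗ₜ[k] (1 : C)) * _
        ring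
      rw [this, map_smul, Finsupp.smul_apply, hcoord, Polynomial.eval₂_monomial, smul_eq_mul,
        mul_comm]
      rfl
  · intro hz
    rw [mem_integralLocus] at hz
    refine eq_top_iff.2 fun u _ => ?_
    induction u with
    | zero => exact zero_mem _
    | add u v hu hv => exact add_mem (hu trivial) (hv trivial)
    | tmul a c =>
      have : a ⊗ₜ[k] c = a ⊗ₜ 1 * h' (1 ⊗ₜ c) := by simp [hh'_tmul]
      rw [this]
      refine mul_mem ?_ (map_mem_integralAt _ _ _)
      obtain ⟨s, hs, hsa⟩ := hz a
      refine ⟨i s, hs, ?_⟩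
      have hmap := hsa.map (Algebra.TensorProduct.includeLeft : A →ₐ[k] A ⊗[k] C).toRingHom
      have hsq : (Algebra.TensorProduct.includeLeft : A →ₐ[k] A ⊗[k] C).toRingHom.comp h.toRingHom =
          h'.comp i := RingHom.ext fun s => by
        change h s ⊗ₜ[k] 1 = h' (s ⊗ₜ 1)
        rw [hh'_tmul]
      rw [hsq] at hmap
      have hint : h'.IsIntegralElem ((h s * a) ⊗ₜ[k] (1 : C)) := hmap.of_comp
      rwa [hi, hh'_tmul, Algebra.TensorProduct.tmul_mul_tmul, mul_one]

end BaseChange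

noncomputable section Equivariance

variable {k : Type*} [Field k] {S A : Type*} [CommRing S] [Algebra k S] [CommRing A]
  [HopfAlgebra k A]

open Algebra.TensorProduct Bialgebra

/-- The action of `G` on itself by right translations. -/
def regularAction (k A : Type*) [Field k] [CommRing A] [HopfAlgebra k A] : RightAction k A A where
  comorphism := comulAlgHom k A
  mul_act := by
    ext a
    exact Coalgebra.coassoc_apply a
  one_act := by
    ext a
    have h : ∀ u : A ⊗[k] A, map (AlgHom.id k A) (counitAlgHom k A) u =
      LinearMap.lTensor A (Coalgebra.counit (R := k)) u := fun u => rfl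
    simp [h]

/-- For an endomorphism `e` of `A`, the comorphism of the map `Y × G → Y × G`,
`(y, g) ↦ (y e(g), g)`. -/
def RightAction.shear (α : RightAction k S A) (e : A →ₐ[k] A) : S ⊗[k] A →ₐ[k] S ⊗[k] A :=
  lift ((map (AlgHom.id k S) e).comp α.comorphism) includeRight fun _ _ => Commute.all _ _

lemma RightAction.map_counit_comp_comorphism (α : RightAction k S A) :
    (map (AlgHom.id k S) ((Algebra.ofId k A).comp (counitAlgHom k A))).comp α.comorphism =
      includeLeft := by
  have h : (map (AlgHom.id k S) (Algebra.ofId k A)).comp (map (AlgHom.id k S) (counitAlgHom k A)) =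
    map (AlgHom.id k S) ((Algebra.ofId k A).comp (counitAlgHom k A)) := by
      rw [← map_comp, AlgHom.id_comp]
  have h2 : map (AlgHom.id k S) (Algebra.ofId k A) =
      (includeLeft : S →ₐ[k] S ⊗[k] A).comp (Algebra.TensorProduct.rid k k S).toAlgHom := by
    ext s
    simp
  rw [← h, h2, AlgHom.comp_assoc, AlgHom.comp_assoc, α.one_act, AlgHom.comp_id]

lemma RightAction.shear_comp_map_comp_comorphism (α : RightAction k S A) (e d : A →ₐ[k] A) :
    (α.shear e).comp ((map (AlgHom.id k S) d).comp α.comorphism) =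
      (map (AlgHom.id k S) ((lift e d fun _ _ => Commute.all _ _).comp (comulAlgHom k A))).comp
        α.comorphism := by
  have h1 : map (AlgHom.id k S) ((lift e d fun _ _ => Commute.all _ _).comp (comulAlgHom k A)) =
      (map (AlgHom.id k S) (lift e d fun _ _ => Commute.all _ _)).comp
        (map (AlgHom.id k S) (comulAlgHom k A)) := by
    rw [← map_comp, AlgHom.id_comp]
  have h2 : ((map (AlgHom.id k S) (lift e d fun _ _ => Commute.all _ _)).comp
      (Algebra.TensorProduct.assoc k k k S A A).toAlgHom).comp includeLeft =
        map (AlgHom.id k S) e := by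
    ext s <;> simp
  have h3 : (α.shear e).comp (map (AlgHom.id k S) d) =
      ((map (AlgHom.id k S) (lift e d fun _ _ => Commute.all _ _)).comp
        (Algebra.TensorProduct.assoc k k k S A A).toAlgHom).comp
          (map α.comorphism (AlgHom.id k A)) := by
    ext s
    · have := DFunLike.congr_fun h2 (α.comorphism s)
      simp only [RightAction.shear, AlgHom.comp_apply, includeLeft_apply, map_tmul, map_one,
        lift_tmul, mul_one] at this ⊢
      exact this.symm
    · simp [RightAction.shear, Algebra.TensorProduct.one_def]
  rw [h1, AlgHom.comp_assoc, ← α.mul_act, ← AlgHom.comp_assoc, h3]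
  simp only [AlgHom.comp_assoc]

lemma RightAction.shear_comp_shear (α : RightAction k S A) (e d : A →ₐ[k] A)
    (h : (lift e d fun _ _ => Commute.all _ _).comp (comulAlgHom k A) =
      (Algebra.ofId k A).comp (counitAlgHom k A)) :
    (α.shear e).comp (α.shear d) = AlgHom.id k _ := by
  apply Algebra.TensorProduct.ext
  · have h' := α.shear_comp_map_comp_comorphism e d
    rw [h, α.map_counit_comp_comorphism] at h'
    ext s
    simpa [RightAction.shear, ← Algebra.TensorProduct.one_def] using DFunLike.congr_fun h' s
  · ext a
    simp [RightAction.shear]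

/-- The automorphism `(y, g) ↦ (y g, g)` of `Y × G`. -/
def RightAction.shearEquiv (α : RightAction k S A) : S ⊗[k] A ≃ₐ[k] S ⊗[k] A :=
  AlgEquiv.ofAlgHom (α.shear (AlgHom.id k A)) (α.shear (HopfAlgebra.antipodeAlgHom k A))
    (α.shear_comp_shear _ _ <| by
      ext a
      have h : ∀ u : A ⊗[k] A, lift (AlgHom.id k A) (HopfAlgebra.antipodeAlgHom k A)
          (fun _ _ => Commute.all _ _) u =
            LinearMap.mul' k A ((HopfAlgebra.antipode k).lTensor A u) := by
        intro u
        induction u <;> simp_all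
      simp [h, Algebra.ofId_apply])
    (α.shear_comp_shear _ _ <| by
      ext a
      have h : ∀ u : A ⊗[k] A, lift (HopfAlgebra.antipodeAlgHom k A) (AlgHom.id k A)
          (fun _ _ => Commute.all _ _) u =
            LinearMap.mul' k A ((HopfAlgebra.antipode k).rTensor A u) := by
        intro u
        induction u <;> simp_all
      simp [h, Algebra.ofId_apply])

lemma RightAction.comul_comp_orbitHom (α : RightAction k S A) (y : S →ₐ[k] k) :
    (comulAlgHom k A).comp (α.orbitHom y) =
      (map (α.orbitHom y) (AlgHom.id k A)).comp α.comorphism := by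
  have h1 : (comulAlgHom k A).comp ((Algebra.TensorProduct.lid k A).toAlgHom.comp
      (map y (AlgHom.id k A))) =
      ((Algebra.TensorProduct.lid k (A ⊗[k] A)).toAlgHom.comp
        (map y (AlgHom.id k (A ⊗[k] A)))).comp (map (AlgHom.id k S) (comulAlgHom k A)) := by
    ext s <;> simp
  have h2 : ((Algebra.TensorProduct.lid k (A ⊗[k] A)).toAlgHom.comp
        (map y (AlgHom.id k (A ⊗[k] A)))).comp (Algebra.TensorProduct.assoc k k k S A A).toAlgHom =
      map ((Algebra.TensorProduct.lid k A).toAlgHom.comp (map y (AlgHom.id k A)))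
        (AlgHom.id k A) := by
    ext s <;> simp [Algebra.TensorProduct.one_def, TensorProduct.smul_tmul']
  have h3 : α.orbitHom y = ((Algebra.TensorProduct.lid k A).toAlgHom.comp
      (map y (AlgHom.id k A))).comp α.comorphism := rfl
  conv_lhs => rw [h3, ← AlgHom.comp_assoc, h1, AlgHom.comp_assoc, ← α.mul_act, ← AlgHom.comp_assoc,
    h2, ← AlgHom.comp_assoc, ← map_comp, AlgHom.id_comp, ← h3]

/-- The locus of integrality of an orbit morphism is invariant. Its base change along the
projection `Y × G → Y` is the locus of integrality of `G × G → Y × G`, `(g, g') ↦ (y g, g')`, and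
this map commutes with the automorphisms `(y, g') ↦ (y g', g')` and `(g, g') ↦ (g g', g')`. -/
lemma RightAction.isInvariant_integralLocus (α : RightAction k S A) (y : S →ₐ[k] k) :
    α.IsInvariant (integralLocus (α.orbitHom y).toRingHom) := by
  set h := α.orbitHom y
  have hS : α.shearEquiv.toAlgHom.comp includeLeft = α.comorphism := by
    ext s
    change α.shear _ (s ⊗ₜ 1) = _
    simp [RightAction.shear, ← Algebra.TensorProduct.one_def]
  have hsq : (regularAction k A).shearEquiv.toAlgHom.comp (map h (AlgHom.id k A)) =
      (map h (AlgHom.id k A)).comp α.shearEquiv.toAlgHom := by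
    apply Algebra.TensorProduct.ext
    · rw [AlgHom.comp_assoc, AlgHom.comp_assoc, hS]
      rw [← α.comul_comp_orbitHom y]
      ext s
      change (regularAction k A).shear _ (h s ⊗ₜ 1) = _
      simp [RightAction.shear, ← Algebra.TensorProduct.one_def, regularAction, h]
    · ext a
      change (regularAction k A).shear _ (h 1 ⊗ₜ a) = map h (AlgHom.id k A) (α.shear _ (1 ⊗ₜ a))
      simp [RightAction.shear]
  have hsq' : (regularAction k A).shearEquiv.symm.toAlgHom.comp (map h (AlgHom.id k A)) =
      (map h (AlgHom.id k A)).comp α.shearEquiv.symm.toAlgHom := by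
    refine AlgHom.ext fun u => ?_
    have := DFunLike.congr_fun hsq (α.shearEquiv.symm u)
    apply (regularAction k A).shearEquiv.injective
    simpa using this.symm
  ext z
  have hz : PrimeSpectrum.comap α.comorphism.toRingHom z =
      PrimeSpectrum.comap (includeLeft : S →ₐ[k] S ⊗[k] A).toRingHom
        (PrimeSpectrum.comap α.shearEquiv.toAlgHom.toRingHom z) := by
    rw [← hS]; rfl
  rw [Set.mem_preimage, Set.mem_preimage, hz, ← mem_integralLocus_map_id_iff,
    ← mem_integralLocus_map_id_iff]
  constructor
  · exact mem_integralLocus_of_comap_mem (regularAction k A).shearEquiv.surjective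
      (congrArg AlgHom.toRingHom hsq)
  · intro hz
    refine mem_integralLocus_of_comap_mem (g := α.shearEquiv.symm.toAlgHom.toRingHom)
      (regularAction k A).shearEquiv.symm.surjective
      (congrArg AlgHom.toRingHom hsq') ?_
    have : (α.shearEquiv.toAlgHom.toRingHom).comp α.shearEquiv.symm.toAlgHom.toRingHom =
        RingHom.id _ := RingHom.ext fun u => α.shearEquiv.apply_symm_apply u
    rwa [← PrimeSpectrum.comap_comp_apply, this, PrimeSpectrum.comap_id]

/-- An invariant set that meets the orbit contains it: a point `y g` of the orbit
belongs to an invariant set if and only if `y` does. -/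
lemma RightAction.orbitMap_mem_of_isInvariant (α : RightAction k S A) (y : S →ₐ[k] k)
    {D : Set (PrimeSpectrum S)} (hD : α.IsInvariant D) {P : PrimeSpectrum A}
    (hP : α.orbitMap y P ∈ D) (Q : PrimeSpectrum A) : α.orbitMap y Q ∈ D := by
  -- The comorphism of `g ↦ (y, g)`.
  let g : S ⊗[k] A →ₐ[k] A := (Algebra.TensorProduct.lid k A).toAlgHom.comp (map y (AlgHom.id k A))
  have hg : g.comp includeLeft = (Algebra.ofId k A).comp y := by
    ext s
    simp [g, Algebra.ofId_apply, Algebra.algebraMap_eq_smul_one]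
  have key : ∀ P, α.orbitMap y P ∈ D ↔ PrimeSpectrum.comap y.toRingHom ⊥ ∈ D := by
    intro P
    have h := congrArg (fun E => PrimeSpectrum.comap g.toRingHom P ∈ E) hD
    have hP : PrimeSpectrum.comap (includeLeft : S →ₐ[k] S ⊗[k] A).toRingHom
        (PrimeSpectrum.comap g.toRingHom P) =
          PrimeSpectrum.comap y.toRingHom (PrimeSpectrum.comap (algebraMap k A) P) := by
      rw [← PrimeSpectrum.comap_comp_apply, ← PrimeSpectrum.comap_comp_apply]
      exact congrArg (fun φ : S →ₐ[k] A => PrimeSpectrum.comap φ.toRingHom P) hg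
    rw [Set.mem_preimage, Set.mem_preimage, hP, Subsingleton.elim
      (PrimeSpectrum.comap (algebraMap k A) P) ⊥] at h
    exact Iff.of_eq h
  exact (key Q).2 ((key P).1 hP)

end Equivariance

/-! ### The image of the points at infinity -/

noncomputable section Elimination

open MvPolynomial

/-- Nakayama's lemma at a prime `q`, with denominators cleared: if `N ⊆ P + q N` locally at `q`,
then `N ⊆ P` locally at `q`. -/
lemma exists_smul_mem_of_smul_mem_sup_smul {R E : Type*} [CommRing R] [AddCommGroup E] [Module R E]
    {N P : Submodule R E} (hN : N.FG) {q : Ideal R} [q.IsPrime] {b : R} (hb : b ∉ q)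
    (h : ∀ v ∈ N, b • v ∈ P ⊔ q • N) : ∃ s ∉ q, ∀ v ∈ N, s • v ∈ P := by
  let Q := N.map P.mkQ
  have : Module.Finite R Q := Module.Finite.iff_fg.2 (hN.map _)
  obtain ⟨p, hp, -, hpq, hp0⟩ :=
    LinearMap.exists_monic_and_natDegree_eq_and_coeff_mem_pow_and_aeval_eq_zero R
      (algebraMap R (Module.End R Q) b) q (by
        rintro _ ⟨⟨_, v, hv, rfl⟩, rfl⟩
        rw [Submodule.mem_smul_top_iff]
        change b • P.mkQ v ∈ q • Q
        have := Submodule.mem_map_of_mem (f := P.mkQ) (h v hv)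
        rwa [Submodule.map_sup, Submodule.map_smul'', map_smul, Submodule.mkQ_map_self,
          bot_sup_eq] at this)
  refine ⟨p.eval b, ?_, fun v hv => ?_⟩
  · -- Modulo `q`, the monic polynomial `p` is a power of `X`.
    rw [Polynomial.eval_eq_sum_range, Finset.sum_range_succ, hp.coeff_natDegree, one_mul]
    intro hmem
    refine hb (Ideal.IsPrime.mem_of_pow_mem ‹_› p.natDegree ((Ideal.add_mem_iff_right _ ?_).1 hmem))
    refine Ideal.sum_mem _ fun i hi => Ideal.mul_mem_right _ _ ?_
    exact Ideal.pow_le_self (Nat.sub_ne_zero_of_lt (Finset.mem_range.1 hi)) (hpq i)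
  · rw [Polynomial.aeval_algebraMap_apply_eq_algebraMap_eval] at hp0
    have := congrArg Subtype.val (DFunLike.congr_fun hp0 ⟨P.mkQ v, v, hv, rfl⟩)
    change p.eval b • P.mkQ v = 0 at this
    rwa [← map_smul, Submodule.mkQ_apply, Submodule.Quotient.mk_eq_zero] at this

lemma isIntegral_of_forall_mul_mem {R A : Type*} [CommRing R] [CommRing A] [Algebra R A]
    {N : Submodule R A} (hN : N.FG) (h1 : 1 ∈ N) {a : A} (ha : ∀ v ∈ N, a * v ∈ N) :
    IsIntegral R a := by
  have : Module.Finite R N := Module.Finite.iff_fg.2 hN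
  let e : Module.End R N := (LinearMap.mulLeft R a).restrict ha
  obtain ⟨p, hp, hpe⟩ := LinearMap.exists_monic_and_aeval_eq_zero R e
  refine ⟨p, hp, ?_⟩
  have hcoe : ∀ r : Polynomial R, ∀ v : N, (Polynomial.aeval e r v : A) =
      Polynomial.aeval a r * v := by
    intro r
    induction r using Polynomial.induction_on' with
    | add r r' h h' => intro v; simp [h, h', add_mul]
    | monomial m c =>
      intro v
      have : ∀ m : ℕ, ((e ^ m) v : A) = a ^ m * v := by
        intro m
        induction m with
        | zero => simp
        | succ m ih =>
          rw [pow_succ', pow_succ', Module.End.mul_apply, mul_assoc, ← ih]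
          rfl
      simp [Polynomial.aeval_monomial, this, Algebra.smul_def, mul_assoc]
  have := hcoe p ⟨1, h1⟩
  rw [hpe] at this
  simpa [Polynomial.aeval_def] using this.symm

variable {B : Type*} [CommRing B] {n : ℕ}

/-- The values at `(1, x₁, …, xₙ)` of the forms of degree `d`; equivalently, the values at `x` of
the polynomials of degree at most `d`. -/
def formValues {A : Type*} [CommRing A] [Algebra B A] (x : Fin n → A) (d : ℕ) : Submodule B A :=
  (homogeneousSubmodule (Fin (n + 1)) B d).map
    (aeval (Fin.cons 1 x : Fin (n + 1) → A)).toLinearMap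

section FormValues

variable {A : Type*} [CommRing A] [Algebra B A] (x : Fin n → A)

lemma aeval_mem_formValues {d : ℕ} {g : MvPolynomial (Fin (n + 1)) B} (hg : g.IsHomogeneous d) :
    aeval (Fin.cons 1 x : Fin (n + 1) → A) g ∈ formValues (B := B) x d :=
  ⟨g, hg, rfl⟩

lemma formValues_fg (d : ℕ) : (formValues (B := B) x d).FG :=
  (homogeneousSubmodule_fg _ _ d).map _

lemma one_mem_formValues (d : ℕ) : 1 ∈ formValues (B := B) x d := by
  have := aeval_mem_formValues (B := B) x ((isHomogeneous_X B (0 : Fin (n + 1))).pow d)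
  simpa using this

lemma mul_mem_formValues_succ {d : ℕ} {a : A} (ha : a ∈ formValues (B := B) x d) (i : Fin n) :
    x i * a ∈ formValues (B := B) x (d + 1) := by
  obtain ⟨g, hg, rfl⟩ := ha
  have := aeval_mem_formValues (B := B) x (IsHomogeneous.mul (isHomogeneous_X B i.succ) hg)
  rw [add_comm d]
  simpa using this

/-- If, locally at `q` and modulo `q`, every value of a form of degree `d + 1` is the value of a
form of degree `d`, then the coordinates are integral locally at `q`: by Nakayama's lemma, a
multiple of each coordinate maps the finite module `formValues x d` into itself. -/
lemma exists_isIntegral_smul_of_formValues {q : Ideal B} [q.IsPrime] {d : ℕ} {b : B} (hb : b ∉ q)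
    (h : ∀ a ∈ formValues (B := B) x (d + 1),
      b • a ∈ formValues (B := B) x d ⊔ q • formValues (B := B) x (d + 1)) (i : Fin n) :
    ∃ s ∉ q, IsIntegral B (s • x i) := by
  obtain ⟨s, hs, hs'⟩ := exists_smul_mem_of_smul_mem_sup_smul (formValues_fg x (d + 1)) hb h
  refine ⟨s, hs, isIntegral_of_forall_mul_mem (formValues_fg x d) (one_mem_formValues x d) ?_⟩
  intro v hv
  rw [smul_mul_assoc]
  exact hs' _ (mul_mem_formValues_succ x hv i)

end FormValues

lemma homogeneousComponent_X_mul {σ R : Type*} [CommRing R] (i : σ) (g : MvPolynomial σ R) (d : ℕ) :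
    homogeneousComponent (d + 1) (X i * g) = X i * homogeneousComponent d g := by
  let : GradedAlgebra (homogeneousSubmodule σ R) := gradedAlgebra
  have hdec : ∀ (g : MvPolynomial σ R) (d : ℕ), homogeneousComponent d g =
      (DirectSum.decompose (homogeneousSubmodule σ R) g d : MvPolynomial σ R) :=
    fun g d => (decomposition.decompose'_apply g d).symm
  rw [add_comm d, hdec, hdec]
  exact DirectSum.coe_decompose_mul_add_of_left_mem (homogeneousSubmodule σ R)
    (isHomogeneous_X R i) (j := d) (b := g)

variable {A : Type*} [CommRing A]

/-- Evaluation at `(1, x₁, …, xₙ)` over `f`, that is, dehomogenization followed by evaluation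
at `x`. -/
abbrev evalCons (f : B →+* A) (x : Fin n → A) : MvPolynomial (Fin (n + 1)) B →+* A :=
  eval₂Hom f (Fin.cons 1 x)

lemma eval₂Hom_dehomogenize (f : B →+* A) (x : Fin n → A) (g : MvPolynomial (Fin (n + 1)) B) :
    eval₂Hom f x (dehomogenize B n g) = evalCons f x g := by
  have : (eval₂Hom f x).comp (dehomogenize B n) = evalCons f x := by
    ext i
    · simp [dehomogenize]
    · refine Fin.cases ?_ (fun i => ?_) i <;> simp [dehomogenize]
  exact DFunLike.congr_fun this g

lemma mem_affineToProj_comap {f : B →+* A} {x : Fin n → A} {P : PrimeSpectrum A} {d : ℕ}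
    {g : MvPolynomial (Fin (n + 1)) B} (hg : g.IsHomogeneous d) :
    g ∈ (affineToProj (PrimeSpectrum.comap (eval₂Hom f x) P)).asHomogeneousIdeal ↔
      evalCons f x g ∈ P.asIdeal := by
  rw [← eval₂Hom_dehomogenize]
  constructor
  · intro h
    exact Ideal.toIdeal_homogeneousCore_le _
      ((PrimeSpectrum.comap (eval₂Hom f x) P).asIdeal.comap (dehomogenize B n)) h
  · intro h
    exact Ideal.mem_homogeneousCore_of_homogeneous_of_mem ⟨d, hg⟩ h

lemma isNilpotent_evalCons_homogeneousComponent {f : B →+* A} {x : Fin n → A}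
    {g : MvPolynomial (Fin (n + 1)) B}
    (hg : g ∈ ProjectiveSpectrum.vanishingIdeal
      (affineToProj '' Set.range (PrimeSpectrum.comap (eval₂Hom f x)))) (d : ℕ) :
    IsNilpotent (evalCons f x (homogeneousComponent d g)) := by
  rw [nilpotent_iff_mem_prime]
  intro P hP
  have hg' := homogeneousComponent_mem_of_mem
    (ProjectiveSpectrum.vanishingIdeal _).isHomogeneous hg d
  have := (ProjectiveSpectrum.mem_vanishingIdeal _ _).1 hg' _ ⟨_, ⟨⟨P, hP⟩, rfl⟩, rfl⟩
  exact (mem_affineToProj_comap (homogeneousComponent_isHomogeneous d g)).1 this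

/-- The homogeneous ideal of the projective closure of the image of `Spec A` in affine space is
generated by the forms whose dehomogenizations become nilpotent in `A`. -/
lemma mem_projClosure_range_iff {f : B →+* A} {x : Fin n → A} {r : ProjSp B n} :
    r ∈ projClosure (Set.range (PrimeSpectrum.comap (eval₂Hom f x))) ↔
      ∀ d, ∀ g : MvPolynomial (Fin (n + 1)) B, g.IsHomogeneous d →
        IsNilpotent (evalCons f x g) → g ∈ r.asHomogeneousIdeal := by
  rw [projClosure, ← ProjectiveSpectrum.zeroLocus_vanishingIdeal_eq_closure,
    ProjectiveSpectrum.mem_zeroLocus]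
  constructor
  · intro h d g hg hnil
    refine h ?_
    rw [SetLike.mem_coe, ProjectiveSpectrum.mem_vanishingIdeal]
    rintro _ ⟨_, ⟨P, rfl⟩, rfl⟩
    exact (mem_affineToProj_comap hg).2 (nilpotent_iff_mem_prime.1 hnil _ P.isPrime)
  · intro h g hg
    rw [SetLike.mem_coe, ← sum_homogeneousComponent g]
    exact sum_mem fun d _ => h d _ (homogeneousComponent_isHomogeneous d g)
      (isNilpotent_evalCons_homogeneousComponent hg d)

lemma exists_X_notMem (r : ProjSp B n) : ∃ i, X i ∉ r.asHomogeneousIdeal := by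
  by_contra! h
  refine r.not_irrelevant_le fun g hg => ?_
  have hle : idealOfVars (Fin (n + 1)) B ≤ r.asHomogeneousIdeal.toIdeal := by
    rw [idealOfVars, Ideal.span_le]
    rintro _ ⟨i, rfl⟩
    exact h i
  refine hle ?_
  rw [← pow_one (idealOfVars _ _), mem_pow_idealOfVars_iff']
  intro m hm
  rw [Nat.lt_one_iff, Finsupp.degree_eq_zero_iff] at hm
  have h0 : homogeneousComponent 0 g = 0 := by
    rw [← decomposition.decompose'_apply]
    exact (HomogeneousIdeal.mem_irrelevant_iff _ _).1 hg
  rw [homogeneousComponent_zero, C_eq_zero] at h0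
  rw [hm, h0]

/-- No point at infinity lies over a prime `q` at which `A` is integral: homogenizing an equation
`(s xᵢ)ᴺ + ⋯ = 0` gives a form vanishing on the projective closure whose restriction to the
hyperplane `X₀ = 0` is `(s Xᵢ)ᴺ`. -/
lemma imageAtInfinity_range_subset_compl (f : B →+* A) (x : Fin n → A) :
    imageAtInfinity (Set.range (PrimeSpectrum.comap (eval₂Hom f x))) ⊆ (integralLocus f)ᶜ := by
  rintro _ ⟨r, ⟨hr, hr0⟩, rfl⟩ hq
  rw [mem_projClosure_range_iff] at hr
  have hX0 : (X 0 : MvPolynomial (Fin (n + 1)) B) ∈ r.asHomogeneousIdeal := hr0 rfl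
  obtain ⟨i, hi⟩ := exists_X_notMem r
  rcases Fin.eq_zero_or_eq_succ i with rfl | ⟨i, rfl⟩
  · exact hi hX0
  obtain ⟨s, hs, p, hp, hp0⟩ := mem_integralLocus.1 hq (x i)
  set N := p.natDegree
  let g : ℕ → MvPolynomial (Fin (n + 1)) B := fun j =>
    C (p.coeff j) * (C s * X i.succ) ^ j * X 0 ^ (N - j)
  have hghom : (∑ j ∈ Finset.range (N + 1), g j).IsHomogeneous N := by
    refine IsHomogeneous.sum _ _ _ fun j hj => ?_
    have h1 := ((isHomogeneous_C (Fin (n + 1)) s).mul (isHomogeneous_X B i.succ)).pow j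
    have h2 := ((isHomogeneous_C (Fin (n + 1)) (p.coeff j)).mul h1).mul
      ((isHomogeneous_X B (0 : Fin (n + 1))).pow (N - j))
    convert h2 using 1
    have := Finset.mem_range.1 hj
    omega
  have hmem := hr N _ hghom <| by
    suffices evalCons f x (∑ j ∈ Finset.range (N + 1), g j) = 0 from this ▸ IsNilpotent.zero
    rw [← hp0, Polynomial.eval₂_eq_sum_range, map_sum]
    simp [g, N]
  rw [Finset.sum_range_succ] at hmem
  have hlow : ∑ j ∈ Finset.range N, g j ∈ r.asHomogeneousIdeal := by
    refine sum_mem fun j hj => Ideal.mul_mem_left _ _ (Ideal.pow_mem_of_mem _ hX0 _ ?_)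
    exact Nat.sub_pos_of_lt (Finset.mem_range.1 hj)
  have htop : (C s * X i.succ) ^ N ∈ r.asHomogeneousIdeal.toIdeal := by
    have := (Ideal.add_mem_iff_right _ hlow).1 hmem
    simpa [g, N, hp.coeff_natDegree] using this
  rcases r.isPrime.mem_or_mem (r.isPrime.mem_of_pow_mem _ htop) with h | h
  · exact hs h
  · exact hi h

lemma exists_forall_smul_mem {R E : Type*} [CommRing R] [AddCommGroup E] [Module R E]
    {N P : Submodule R E} (hN : N.FG) {q : Ideal R} [q.IsPrime]
    (h : ∀ v ∈ N, ∃ b ∉ q, b • v ∈ P) : ∃ b ∉ q, ∀ v ∈ N, b • v ∈ P := by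
  classical
  obtain ⟨t, rfl⟩ := hN
  choose! b hb hbv using fun v (hv : v ∈ t) => h v (Submodule.subset_span hv)
  refine ⟨∏ v ∈ t, b v, fun hmem => ?_, fun v hv => ?_⟩
  · obtain ⟨v, hv, hvq⟩ := (Ideal.IsPrime.prod_mem_iff).1 hmem
    exact hb v hv hvq
  · induction hv using Submodule.span_induction with
    | zero => simp
    | add v w _ _ hv hw => rw [smul_add]; exact P.add_mem hv hw
    | smul r v _ hv => rw [smul_comm]; exact P.smul_mem r hv
    | mem v hv =>
      rw [← Finset.prod_erase_mul t b hv, mul_smul]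
      exact P.smul_mem _ (hbv v hv)

/-- The projective Nullstellensatz in the fibre over `q`: if a homogeneous ideal `I` contains `q`
and no point of the zero locus of `I` in projective space lies over `q`, then all forms of sufficiently
large degree belong to `I` locally at `q`. -/
lemma exists_isHomogeneous_mul_mem {I : Ideal (MvPolynomial (Fin (n + 1)) B)}
    (hI : I.IsHomogeneous (homogeneousSubmodule (Fin (n + 1)) B)) {q : PrimeSpectrum B}
    (hqI : q.asIdeal.map C ≤ I)
    (hq : ∀ r : ProjSp B n, I ≤ r.asHomogeneousIdeal.toIdeal → projBaseProj r ≠ q) :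
    ∃ N, ∀ d ≥ N, ∀ g : MvPolynomial (Fin (n + 1)) B, g.IsHomogeneous d →
      ∃ b ∉ q.asIdeal, C b * g ∈ I := by
  let K : Ideal (MvPolynomial (Fin (n + 1)) B) :=
    { carrier := {g | ∃ b ∉ q.asIdeal, C b * g ∈ I}
      zero_mem' := ⟨1, q.isPrime.one_notMem, by simp⟩
      add_mem' := by
        rintro g h ⟨b, hb, hg⟩ ⟨c, hc, hh⟩
        refine ⟨b * c, q.isPrime.mul_notMem hb hc, ?_⟩
        convert I.add_mem (I.mul_mem_left (C c) hg) (I.mul_mem_left (C b) hh) using 1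
        rw [C_mul]; ring
      smul_mem' := by
        rintro h g ⟨b, hb, hg⟩
        refine ⟨b, hb, ?_⟩
        rw [smul_eq_mul, mul_left_comm]
        exact I.mul_mem_left _ hg }
  have hle : idealOfVars (Fin (n + 1)) B ≤ K.radical := by
    rw [idealOfVars, Ideal.span_le]
    rintro _ ⟨i, rfl⟩
    by_contra hi
    -- Otherwise a prime containing `I` avoids `X i` and contracts into `q`; its homogeneous core is
    -- a point of projective space over `q`.
    obtain ⟨r', hr', hIr', hdisj⟩ := I.exists_le_prime_disjoint
      (q.asIdeal.primeCompl.map (C (σ := Fin (n + 1))) ⊔ Submonoid.powers (X i)) (by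
        rw [Set.disjoint_left]
        intro g hg hg'
        obtain ⟨_, ⟨b, hb, rfl⟩, _, ⟨m, rfl⟩, rfl⟩ := Submonoid.mem_sup.1 hg'
        exact hi ⟨m, b, hb, hg⟩)
    have hXi : X i ∉ r' := fun h =>
      Set.disjoint_left.1 hdisj h (Submonoid.mem_sup_right (Submonoid.mem_powers _))
    have hcore : (Ideal.homogeneousCore (homogeneousSubmodule (Fin (n + 1)) B) r').toIdeal ≤ r' :=
      Ideal.toIdeal_homogeneousCore_le _ _
    have hIcore :
        I ≤ (Ideal.homogeneousCore (homogeneousSubmodule (Fin (n + 1)) B) r').toIdeal := by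
      rw [← hI.toIdeal_homogeneousCore_eq_self]
      exact Ideal.homogeneousCore_mono _ hIr'
    let r : ProjSp B n :=
      { asHomogeneousIdeal := Ideal.homogeneousCore (homogeneousSubmodule (Fin (n + 1)) B) r'
        isPrime := Ideal.IsPrime.homogeneousCore hr'
        not_irrelevant_le := fun h => hXi <| hcore <| h <|
          HomogeneousIdeal.mem_irrelevant_of_mem _ one_pos (isHomogeneous_X B i) }
    refine hq r hIcore (PrimeSpectrum.ext (le_antisymm (fun b hb => ?_) ?_))
    · by_contra hbq
      exact Set.disjoint_left.1 hdisj (hcore hb) (Submonoid.mem_sup_left ⟨b, hbq, rfl⟩)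
    · exact Ideal.map_le_iff_le_comap.1 (hqI.trans hIcore)
  obtain ⟨N, hN⟩ := Ideal.exists_pow_le_of_le_radical_of_fg hle (idealOfVars_fg _ _)
  refine ⟨N, fun d hd g hg => hN ((mem_pow_idealOfVars_iff' _ _).2 fun m hm => ?_)⟩
  exact hg.coeff_eq_zero (hm.trans_le hd).ne

lemma aeval_homogeneousComponent_mem_smul_formValues [Algebra B A] (x : Fin n → A) {q : Ideal B}
    {g : MvPolynomial (Fin (n + 1)) B} (hg : g ∈ q.map C) (d : ℕ) :
    aeval (Fin.cons 1 x : Fin (n + 1) → A) (homogeneousComponent d g) ∈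
      q • formValues (B := B) x d := by
  have hg' : g ∈ q • (⊤ : Submodule B (MvPolynomial (Fin (n + 1)) B)) := by
    rw [Ideal.smul_top_eq_map]
    exact hg
  refine Submodule.smul_induction_on hg' (fun b hb g _ => ?_) (fun g g' h h' => ?_)
  · rw [map_smul, map_smul]
    exact Submodule.smul_mem_smul hb
      (aeval_mem_formValues x (homogeneousComponent_isHomogeneous d g))
  · rw [map_add, map_add]
    exact add_mem h h'

lemma aeval_homogeneousComponent_mem_formValues [Algebra B A] (x : Fin n → A)
    {g : MvPolynomial (Fin (n + 1)) B} (hg : g ∈ Ideal.span {X 0}) (d : ℕ) :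
    aeval (Fin.cons 1 x : Fin (n + 1) → A) (homogeneousComponent (d + 1) g) ∈
      formValues (B := B) x d := by
  obtain ⟨g, rfl⟩ := Ideal.mem_span_singleton.1 hg
  rw [homogeneousComponent_X_mul, map_mul, aeval_X, Fin.cons_zero, one_mul]
  exact aeval_mem_formValues x (homogeneousComponent_isHomogeneous d g)

lemma aeval_cons_mk_nilradical [Algebra B A] (x : Fin n → A) (g : MvPolynomial (Fin (n + 1)) B) :
    aeval (Fin.cons 1 (fun i => Ideal.Quotient.mk (nilradical A) (x i)) : Fin (n + 1) → _) g =
      Ideal.Quotient.mk (nilradical A) (evalCons (algebraMap B A) x g) := by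
  induction g using MvPolynomial.induction_on with
  | C b => simp
  | add g g' hg hg' => rw [map_add, map_add, map_add, hg, hg']
  | mul_X g i hg =>
    rw [map_mul, map_mul, map_mul, hg, aeval_X, eval₂Hom_X']
    congr 1
    refine Fin.cases ?_ (fun i => ?_) i <;> simp

/-- The complement of the image of the points at infinity is the locus of integrality. -/
theorem imageAtInfinity_range (f : B →+* A) (x : Fin n → A)
    (hx : Function.Surjective (eval₂Hom f x)) :
    imageAtInfinity (Set.range (PrimeSpectrum.comap (eval₂Hom f x))) = (integralLocus f)ᶜ := by
  refine (imageAtInfinity_range_subset_compl f x).antisymm fun q => ?_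
  contrapose!
  intro hqD
  rw [Set.notMem_compl_iff]
  let 𝒜 := homogeneousSubmodule (Fin (n + 1)) B
  let J := ProjectiveSpectrum.vanishingIdeal
    (affineToProj '' Set.range (PrimeSpectrum.comap (eval₂Hom f x)))
  let I₀ : Ideal (MvPolynomial (Fin (n + 1)) B) := J.toIdeal ⊔ Ideal.span {X 0}
  have hI : (I₀ ⊔ q.asIdeal.map C).IsHomogeneous 𝒜 := by
    refine (J.isHomogeneous.sup (Ideal.homogeneous_span _ _ ?_)).sup
      (Ideal.homogeneous_span _ _ ?_)
    · rintro _ rfl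
      exact ⟨1, isHomogeneous_X B 0⟩
    · rintro _ ⟨b, -, rfl⟩
      exact ⟨0, isHomogeneous_C _ b⟩
  obtain ⟨N, hN⟩ := exists_isHomogeneous_mul_mem hI le_sup_right (q := q) (by
    rintro r hr rfl
    refine hqD ⟨r, ⟨?_, ?_⟩, rfl⟩
    · rw [projClosure, ← ProjectiveSpectrum.zeroLocus_vanishingIdeal_eq_closure]
      exact fun g hg => hr (Ideal.mem_sup_left (Ideal.mem_sup_left hg))
    · rintro _ rfl
      exact hr (Ideal.mem_sup_left (Ideal.mem_sup_right (Ideal.mem_span_singleton_self _))))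
  -- Pass to the reduced ring of `A`, on which the forms in `J` vanish.
  algebraize [f]
  let x' : Fin n → A ⧸ nilradical A := fun i => Ideal.Quotient.mk _ (x i)
  have hcomp : ∀ d, ∀ g ∈ I₀ ⊔ q.asIdeal.map C,
      aeval (Fin.cons 1 x' : Fin (n + 1) → _) (homogeneousComponent (d + 1) g) ∈
        formValues (B := B) x' d ⊔ q.asIdeal • formValues (B := B) x' (d + 1) := by
    intro d g hg
    obtain ⟨h, hh, g₂, hg₂, rfl⟩ := Submodule.mem_sup.1 hg
    obtain ⟨g₀, hg₀, g₁, hg₁, rfl⟩ := Submodule.mem_sup.1 hh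
    rw [map_add, map_add, map_add, map_add]
    refine add_mem (add_mem ?_ (Submodule.mem_sup_left ?_)) (Submodule.mem_sup_right ?_)
    · suffices aeval (Fin.cons 1 x' : Fin (n + 1) → _) (homogeneousComponent (d + 1) g₀) = 0 from
        this ▸ zero_mem _
      rw [aeval_cons_mk_nilradical, Ideal.Quotient.eq_zero_iff_mem, mem_nilradical]
      exact isNilpotent_evalCons_homogeneousComponent hg₀ (d + 1)
    · exact aeval_homogeneousComponent_mem_formValues x' hg₁ d
    · exact aeval_homogeneousComponent_mem_smul_formValues x' hg₂ (d + 1)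
  obtain ⟨b, hb, hbN⟩ := exists_forall_smul_mem (formValues_fg (B := B) x' (N + 1))
    (P := formValues (B := B) x' N ⊔ q.asIdeal • formValues (B := B) x' (N + 1))
    (q := q.asIdeal) (by
      rintro _ ⟨g, hg, rfl⟩
      obtain ⟨b, hb, hbg⟩ := hN (N + 1) N.le_succ g hg
      refine ⟨b, hb, ?_⟩
      have := hcomp N _ hbg
      rwa [homogeneousComponent_C_mul, homogeneousComponent_eq_self hg, ← smul_eq_C_mul,
        map_smul] at this)
  refine mem_integralLocus_of_forall_mem hx fun i => ?_
  obtain ⟨s, hs, p, hp, hp0⟩ := exists_isIntegral_smul_of_formValues x' hb hbN i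
  obtain ⟨t, ht, h⟩ : f s * x i ∈ integralAt f q := by
    refine mem_integralAt_of_isNilpotent_eval₂ (p := p) (N := p.natDegree) le_rfl ?_ ?_
    · rw [hp.coeff_natDegree]
      exact q.isPrime.one_notMem
    · rw [← mem_nilradical, ← Ideal.Quotient.eq_zero_iff_mem, ← hp0, Polynomial.hom_eval₂]
      rw [map_mul, Algebra.smul_def]
      rfl
  exact ⟨t * s, q.isPrime.mul_notMem ht hs, by rwa [map_mul, mul_assoc]⟩

end Elimination

/-! ### Injective morphisms of affine schemes whose image lies in the locus of integrality -/

section Embedding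

variable {R A : Type*} [CommRing R] [CommRing A]

/-- An injective morphism of affine schemes that is integral locally over its image is a
topological embedding, since it is closed over its image. -/
lemma isEmbedding_comap_of_range_subset_integralLocus {f : R →+* A}
    (hinj : Function.Injective (PrimeSpectrum.comap f))
    (hW : Set.range (PrimeSpectrum.comap f) ⊆ integralLocus f) :
    Topology.IsEmbedding (PrimeSpectrum.comap f) := by
  have hhomeo : IsHomeomorph (Set.rangeFactorization (PrimeSpectrum.comap f)) := by
    rw [isHomeomorph_iff_continuous_isClosedMap_bijective]
    refine ⟨(PrimeSpectrum.continuous_comap f).rangeFactorization, fun Z hZ => ?_,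
      Set.rangeFactorization_injective.2 hinj, Set.rangeFactorization_surjective⟩
    obtain ⟨I, rfl⟩ := (PrimeSpectrum.isClosed_iff_zeroLocus_ideal Z).1 hZ
    refine ⟨(PrimeSpectrum.zeroLocus (I.comap f))ᶜ,
      (PrimeSpectrum.isClosed_zeroLocus _).isOpen_compl, ?_⟩
    rw [Set.preimage_compl, compl_inj_iff]
    ext ⟨_, P, rfl⟩
    constructor
    · intro hP
      obtain ⟨P', hIP', hP'⟩ := exists_comap_eq_of_mem_integralLocus (hW ⟨P, rfl⟩) I hP
      exact ⟨P', hIP', Subtype.ext hP'⟩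
    · rintro ⟨P', hP', h⟩
      rw [← h]
      exact Ideal.comap_mono (f := f) hP'
  exact Topology.IsEmbedding.subtypeVal.comp hhomeo.isEmbedding

/-- If the image lies in the locus of integrality, then it consists of the points of its closure
that lie in this locus. -/
lemma closure_range_inter_integralLocus {f : R →+* A}
    (hW : Set.range (PrimeSpectrum.comap f) ⊆ integralLocus f) :
    closure (Set.range (PrimeSpectrum.comap f)) ∩ integralLocus f =
      Set.range (PrimeSpectrum.comap f) := by
  refine Set.Subset.antisymm ?_ (Set.subset_inter subset_closure hW)
  rintro q ⟨hq, hqW⟩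
  rw [PrimeSpectrum.closure_range_comap] at hq
  obtain ⟨P, -, hP⟩ := exists_comap_eq_of_mem_integralLocus hqW ⊥ hq
  exact ⟨P, hP⟩

/-- Outside the closure of the image, `A` is integral because it is locally zero. -/
lemma compl_integralLocus_subset_closure_range (f : R →+* A) :
    (integralLocus f)ᶜ ⊆ closure (Set.range (PrimeSpectrum.comap f)) := by
  intro q hq
  by_contra hqc
  refine hq (mem_integralLocus.2 fun a => ?_)
  rw [PrimeSpectrum.closure_range_comap, PrimeSpectrum.mem_zeroLocus, Set.not_subset] at hqc
  obtain ⟨s, hs, hsq⟩ := hqc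
  have hs0 : f s = 0 := hs
  refine ⟨s, hsq, ?_⟩
  rw [hs0, zero_mul]
  exact f.isIntegralElem_zero

lemma comap_mem_integralLocus_iff_of_surjective {B S : Type*} [CommRing B] [CommRing S]
    {φ : B →+* S} (hφ : Function.Surjective φ) (h : S →+* A) (q : PrimeSpectrum S) :
    PrimeSpectrum.comap φ q ∈ integralLocus (h.comp φ) ↔ q ∈ integralLocus h := by
  constructor
  · exact mem_integralLocus_of_comap_mem (f := h.comp φ) (f' := h) (g := φ) (g' := RingHom.id A)
      Function.surjective_id rfl
  · rw [mem_integralLocus, mem_integralLocus]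
    intro hq a
    obtain ⟨s, hs, p, hp, hp0⟩ := hq a
    obtain ⟨b, rfl⟩ := hφ s
    have : Nontrivial S := ⟨φ b, 0, fun h => hs (h ▸ q.asIdeal.zero_mem)⟩
    obtain ⟨p', rfl, -, hp'⟩ := Polynomial.lifts_and_degree_eq_and_monic
      ((Polynomial.lifts_iff_set_range _).2 (Polynomial.map_surjective φ hφ p)) hp
    exact ⟨b, hs, p', hp', by rwa [Polynomial.eval₂_map] at hp0⟩

lemma topologicalKrullDim_range {X Y : Type*} [TopologicalSpace X] [TopologicalSpace Y] {f : X → Y}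
    (hf : Topology.IsEmbedding f) : topologicalKrullDim (Set.range f) = topologicalKrullDim X :=
  (hf.toHomeomorph.isHomeomorph.topologicalKrullDim_eq _).symm

lemma topologicalKrullDim_singleton {X : Type*} [TopologicalSpace X] (x : X) :
    topologicalKrullDim ({x} : Set X) = 0 := by
  refine le_antisymm (topologicalKrullDim_zero_of_discreteTopology _) ?_
  have : Nonempty (TopologicalSpace.IrreducibleCloseds ({x} : Set X)) :=
    ⟨⟨closure {⟨x, rfl⟩}, isIrreducible_singleton.closure, isClosed_closure⟩⟩
  exact Order.krullDim_nonneg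

end Embedding

/-! ### Orbits -/

section Orbit

variable {k : Type*} [Field k] {S A : Type*} [CommRing S] [Algebra k S] [CommRing A]
  [HopfAlgebra k A]

lemma nontrivial_of_hopfAlgebra (k A : Type*) [Field k] [CommRing A] [HopfAlgebra k A] :
    Nontrivial A :=
  (Bialgebra.counitAlgHom k A).toRingHom.domain_nontrivial

/-- An injective orbit morphism is integral locally over the orbit: it is so generically, and the
locus of integrality is invariant. -/
theorem RightAction.range_orbitMap_subset_integralLocus [Algebra.FiniteType k A]
    (α : RightAction k S A) (y : S →ₐ[k] k) (hinj : Function.Injective (α.orbitMap y)) :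
    Set.range (α.orbitMap y) ⊆ integralLocus (α.orbitHom y).toRingHom := by
  have := nontrivial_of_hopfAlgebra k A
  set h := (α.orbitHom y).toRingHom
  have hft : h.FiniteType :=
    RingHom.FiniteType.of_comp_finiteType (f := algebraMap k S) (by
      change ((α.orbitHom y : S →+* A).comp (algebraMap k S)).FiniteType
      rw [(α.orbitHom y).comp_algebraMap]
      exact RingHom.finiteType_algebraMap.2 inferInstance)
  obtain ⟨q, hq⟩ := (RingHom.ker h).nonempty_minimalPrimes (RingHom.ker_ne_top h)
  obtain ⟨P, hP, -, hPq⟩ := Ideal.exists_comap_eq_of_mem_minimalPrimes (I := ⊥) h q hq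
  have hmem : α.orbitMap y ⟨P, hP⟩ ∈ integralLocus h :=
    mem_integralLocus_of_mem_minimalPrimes hft hinj (by
      change P.comap h ∈ _
      rwa [hPq])
  rintro _ ⟨Q, rfl⟩
  exact α.orbitMap_mem_of_isInvariant y (α.isInvariant_integralLocus y) hmem Q

end Orbit

/-! ### The algorithms on inputs for which they stop at once -/

section Algorithms

variable {k : Type*} [Field k] {B : Type*} [CommRing B] [Algebra k B] {n : ℕ}

lemma zeroDimensionalFibers_iff_of_not_positiveFiberDim {Γ : Set (AffineSp B n)}
    (h : ¬ PositiveFiberDim Γ) (Γ₀' : Set (AffineSp B n)) (l : List (Set (AffineSp B n))) :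
    ZeroDimensionalFibers k Γ Γ₀' l ↔ Γ₀' = Γ ∧ l = [] := by
  constructor
  · intro hl
    cases hl with
    | exit => exact ⟨rfl, rfl⟩
    | pass h' => exact absurd h' h
  · rintro ⟨rfl, rfl⟩
    exact .exit h

lemma locallyClosedApprox_iff_of_not_positiveFiberDim {Γ : Set (AffineSp B n)}
    (h : ¬ PositiveFiberDim Γ) (C D : Set (PrimeSpectrum B)) :
    LocallyClosedApprox k Γ C D ↔ LocallyClosedApproxSkip Γ C D := by
  simp [LocallyClosedApprox, LocallyClosedApproxSkip,
    zeroDimensionalFibers_iff_of_not_positiveFiberDim h]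

lemma constructibleProjection_iff_of_inter_eq_empty
    {lca : Set (AffineSp B n) → Set (PrimeSpectrum B) → Set (PrimeSpectrum B) → Prop}
    {Γ : Set (AffineSp B n)} (hne : Γ.Nonempty) {C₀ D₀ : Set (PrimeSpectrum B)}
    (hlca : ∀ C D, lca Γ C D ↔ C = C₀ ∧ D = D₀) (hD₀ : Γ ∩ baseProj ⁻¹' D₀ = ∅)
    (L : List (Set (PrimeSpectrum B) × Set (PrimeSpectrum B))) :
    ConstructibleProjection lca Γ L ↔ L = [(C₀, D₀)] := by
  constructor
  · intro hL
    cases hL with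
    | done => exact absurd hne Set.not_nonempty_empty
    | iterate _ hcall hrest =>
      obtain ⟨rfl, rfl⟩ := (hlca _ _).1 hcall
      rw [hD₀] at hrest
      cases hrest with
      | done => rfl
      | iterate hne' => exact absurd hne' Set.not_nonempty_empty
  · rintro rfl
    refine .iterate hne ((hlca _ _).2 ⟨rfl, rfl⟩) ?_
    rw [hD₀]
    exact .done

end Algorithms

/-! ### Graphs in affine space -/

section Graph

open MvPolynomial

lemma eval₂Hom_surjective_of_adjoin_eq_top {k A B σ : Type*} [CommRing k] [CommRing A] [CommRing B]
    [Algebra k A] [Algebra k B] {x : σ → A} (hx : Algebra.adjoin k (Set.range x) = ⊤)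
    (f : B →ₐ[k] A) : Function.Surjective (eval₂Hom f.toRingHom x) := by
  intro a
  have ha : a ∈ Algebra.adjoin k (Set.range x) := hx ▸ Algebra.mem_top
  rw [Algebra.adjoin_range_eq_range_aeval] at ha
  obtain ⟨p, rfl⟩ := ha
  refine ⟨p.map (algebraMap k B), ?_⟩
  change eval₂ (f : B →+* A) x (p.map (algebraMap k B)) = aeval x p
  rw [eval₂_map, f.comp_algebraMap, aeval_def]

lemma baseProj_comap_eval₂Hom {A B : Type*} [CommRing A] [CommRing B] {n : ℕ} (f : B →+* A)
    (x : Fin n → A) (P : PrimeSpectrum A) :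
    baseProj (PrimeSpectrum.comap (eval₂Hom f x) P) = PrimeSpectrum.comap f P := by
  rw [baseProj, ← PrimeSpectrum.comap_comp_apply]
  congr 2
  ext b
  simp

end Graph

end OrbitImage

/-! ### The orbit and its relative boundary -/

open OrbitImage in
theorem mainTheorem8
    -- the base field
    {k : Type*} [Field k]
    -- the affine algebraic group `G = Spec A`, a closed subset of `𝔸ⁿ_k` with coordinates `x`
    {A : Type*} [CommRing A] [HopfAlgebra k A]
    {n : ℕ} (x : Fin n → A) (hx : Algebra.adjoin k (Set.range x) = ⊤)
    -- the affine variety `Y = Spec S`, a closed subset of `Spec B` (for example of `𝔸ᵐ_k`, or `Y`)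
    {B : Type*} [CommRing B] [Algebra k B] [Algebra.FiniteType k B]
    {S : Type*} [CommRing S] [Algebra k S]
    (φ : B →ₐ[k] S) (hφ : Function.Surjective φ)
    -- the action, the point `y`, and the injective orbit morphism
    (α : RightAction k S A) (y : S →ₐ[k] k)
    (hinj : Function.Injective (α.orbitMap y))
    -- the orbit `yG` in `Spec B`, and the graph `Γ` of the orbit morphism
    (orb : Set (PrimeSpectrum B))
    (horb : orb = PrimeSpectrum.comap φ.toRingHom '' Set.range (α.orbitMap y))
    (Γ : Set (AffineSp B n)) (hΓ : Γ = graph ((α.orbitHom y).comp φ) x) :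
    -- `Γ` is closed, projects onto the orbit, and its nonempty fibres are zero-dimensional,
    -- so that the fibre dimension reduction returns `Γ` at once and can be skipped
    (IsClosed Γ ∧ baseProj '' Γ = orb) ∧
    (∀ p ∈ baseProj '' Γ, topologicalKrullDim ↥(Γ ∩ baseProj ⁻¹' {p}) = 0) ∧
    topologicalKrullDim ↥Γ = topologicalKrullDim ↥(baseProj '' Γ) ∧
    (∀ Γ₀' l, ZeroDimensionalFibers k Γ Γ₀' l ↔ Γ₀' = Γ ∧ l = []) ∧
    (∀ C D, LocallyClosedApprox k Γ C D ↔ LocallyClosedApproxSkip Γ C D) ∧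
    -- the hull `π̂(Γ^∞)` is a `G`-equivariant relative boundary hull and is the relative boundary
    IsRelativeBoundaryHull (imageAtInfinity Γ) orb ∧
    α.IsInvariant (PrimeSpectrum.comap φ.toRingHom ⁻¹' imageAtInfinity Γ) ∧
    imageAtInfinity Γ = relativeBoundary orb ∧
    (∀ C D, LocallyClosedApproxSkip Γ C D ↔ C = closure orb ∧ D = relativeBoundary orb) ∧
    -- the outer iteration stops after a single call, with or without the skipped step,
    -- and outputs the orbit
    Γ ∩ baseProj ⁻¹' imageAtInfinity Γ = ∅ ∧
    (∀ L, ConstructibleProjection (LocallyClosedApprox k) Γ L ↔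
      L = [(closure orb, relativeBoundary orb)]) ∧
    (∀ L, ConstructibleProjection LocallyClosedApproxSkip Γ L ↔
      L = [(closure orb, relativeBoundary orb)]) ∧
    orb = closure orb \ relativeBoundary orb := by
  set h := (α.orbitHom y).toRingHom
  set f : B →+* A := ((α.orbitHom y).comp φ).toRingHom
  have := nontrivial_of_hopfAlgebra k A
  have : Algebra.FiniteType k A :=
    ⟨Subalgebra.fg_def.2 ⟨Set.range x, Set.finite_range x, hx⟩⟩
  have hsurj : Function.Surjective (MvPolynomial.eval₂Hom f x) :=
    eval₂Hom_surjective_of_adjoin_eq_top hx _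
  have hfinj : Function.Injective (PrimeSpectrum.comap f) := fun P Q hPQ =>
    hinj (PrimeSpectrum.comap_injective_of_surjective φ.toRingHom hφ hPQ)
  have horb' : orb = Set.range (PrimeSpectrum.comap f) := by
    rw [horb, ← Set.range_comp]
    rfl
  have hΓ' : Γ = Set.range (PrimeSpectrum.comap (MvPolynomial.eval₂Hom f x)) := hΓ
  -- The orbit lies in the locus of integrality, whose complement is the image at infinity.
  have hW : orb ⊆ integralLocus f := by
    rw [horb']
    rintro _ ⟨P, rfl⟩
    exact (comap_mem_integralLocus_iff_of_surjective hφ h _).2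
      (α.range_orbitMap_subset_integralLocus y hinj ⟨P, rfl⟩)
  have hD : imageAtInfinity Γ = (integralLocus f)ᶜ := by
    rw [hΓ', imageAtInfinity_range f x hsurj]
  have hDopen : IsOpen (integralLocus f) := isOpen_integralLocus hsurj
  have hne : orb.Nonempty := by
    rw [horb']
    exact Set.range_nonempty _
  have hcl : closure orb ∩ integralLocus f = orb := by
    rw [horb'] at hW ⊢
    exact closure_range_inter_integralLocus hW
  have hDcl : (integralLocus f)ᶜ ⊆ closure orb := by
    rw [horb']
    exact compl_integralLocus_subset_closure_range f
  have hdiff : closure orb \ orb = (integralLocus f)ᶜ := by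
    ext q
    constructor
    · rintro ⟨hq, hqo⟩ hqW
      exact hqo (hcl ▸ ⟨hq, hqW⟩)
    · intro hq
      exact ⟨hDcl hq, fun hqo => hq (hW hqo)⟩
  have hbd : relativeBoundary orb = (integralLocus f)ᶜ := by
    rw [relativeBoundary, hdiff]
    exact hDopen.isClosed_compl.closure_eq
  have hproj : baseProj '' Γ = orb := by
    rw [hΓ', horb', ← Set.range_comp]
    exact congrArg Set.range (funext fun P => baseProj_comap_eval₂Hom f x P)
  have hemb := PrimeSpectrum.isClosedEmbedding_comap_of_surjective _ _ hsurj
  have hdim : topologicalKrullDim ↥Γ = topologicalKrullDim ↥(baseProj '' Γ) := by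
    rw [hproj, hΓ', horb', topologicalKrullDim_range hemb.isEmbedding, topologicalKrullDim_range
      (isEmbedding_comap_of_range_subset_integralLocus hfinj (horb' ▸ hW))]
  have hpos : ¬ PositiveFiberDim Γ := by
    rw [PositiveFiberDim, hdim]
    exact lt_irrefl _
  have hempty : Γ ∩ baseProj ⁻¹' imageAtInfinity Γ = ∅ := by
    rw [hD, Set.eq_empty_iff_forall_notMem]
    rintro p ⟨hp, hpD⟩
    exact hpD (hW (hproj ▸ Set.mem_image_of_mem _ hp))
  have hΓne : Γ.Nonempty := by
    rw [hΓ']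
    exact Set.range_nonempty _
  have hskip : ∀ C D,
      LocallyClosedApproxSkip Γ C D ↔ C = closure orb ∧ D = relativeBoundary orb := by
    intro C D
    rw [LocallyClosedApproxSkip, hproj, hD, hbd]
  have hlca := locallyClosedApprox_iff_of_not_positiveFiberDim (k := k) hpos
  have hbdD : imageAtInfinity Γ = relativeBoundary orb := hD.trans hbd.symm
  refine ⟨⟨?_, hproj⟩, ?_, hdim, zeroDimensionalFibers_iff_of_not_positiveFiberDim hpos, hlca,
    ⟨?_, fun h0 => absurd h0 hne.ne_empty, fun _ => ?_, fun _ => ?_⟩, ?_, hbdD, hskip, hempty,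
    constructibleProjection_iff_of_inter_eq_empty hΓne (fun C D => (hlca C D).trans (hskip C D))
      (hbdD ▸ hempty),
    constructibleProjection_iff_of_inter_eq_empty hΓne hskip (hbdD ▸ hempty), ?_⟩
  · rw [hΓ']
    exact hemb.isClosed_range
  · rintro _ ⟨p, hp, rfl⟩
    have : Γ ∩ baseProj ⁻¹' {baseProj p} = {p} := by
      refine Set.eq_singleton_iff_unique_mem.2 ⟨⟨hp, rfl⟩, ?_⟩
      rintro p' ⟨hp', hpp'⟩
      rw [hΓ'] at hp hp'
      obtain ⟨P, rfl⟩ := hp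
      obtain ⟨P', rfl⟩ := hp'
      rw [Set.mem_preimage, Set.mem_singleton_iff, baseProj_comap_eval₂Hom,
        baseProj_comap_eval₂Hom] at hpp'
      rw [hfinj hpp']
    rw [this, topologicalKrullDim_singleton]
  · rw [hD]
    exact hDopen.isClosed_compl
  · rw [hD, hdiff]
  · rw [hD]
    obtain ⟨q, hq⟩ := hne
    exact ⟨hDcl, fun hle => hle (subset_closure hq) (hW hq)⟩
  · have hpre : PrimeSpectrum.comap φ.toRingHom ⁻¹' imageAtInfinity Γ = (integralLocus h)ᶜ := by
      rw [hD]
      ext q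
      exact not_congr (comap_mem_integralLocus_iff_of_surjective hφ h q)
    rw [hpre, RightAction.IsInvariant, Set.preimage_compl, Set.preimage_compl]
    exact congrArg _ (α.isInvariant_integralLocus y)
  · rw [hbd, ← hdiff, Set.sdiff_sdiff_cancel_left subset_closure]
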